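/- **Setting.** Let $p_*\ge 1$ be an integer; put $p=p_*/2$ if $p_*$ is even and $p=p_*$ if $p_*$ is odd. Let $N\ge1$, $b\in\mathbb R$, $k\in\mathbb Z/N\mathbb Z$, $c_k=\cos(b+\frac{\pi k}{N})$ (only $|c_k|$ is used, so any integer representative of $k$ may be taken), and assume $c_k\neq0$. For a real $p_*$-periodic sequence $v=(v_n)_{n\in\mathbb Z}$ and $t\ge 0$ consider the Jacobi operator $$(J_k^b(t)y)_n=a_{n-1}y_{n-1}+a_ny_{n+1}+t\,v_ny_n,\qquad a_{2n}=2|c_k|,\quad a_{2n+1}=1 .$$ Its coefficients are $2p$-periodic. Its $4p$ eigenvalues on $4p$-periodic sequences, repeated according to multiplicity and put in increasing order, are denoted $$z_{k,0}^{b,+}(t)<z_{k,1}^{b,-}(t)\le z_{k,1}^{b,+}(t)<z_{k,2}^{b,-}(t)\le z_{k,2}^{b,+}(t)<\dots<z_{k,2p}^{b,-}(t);$$ these are the edges of the spectral bands, and $\gamma_{k,n}^b(t)=(z_{k,n}^{b,-}(t),z_{k,n}^{b,+}(t))$, $1\le n\le 2p-1$, are the (possibly empty) gaps. Let $\tau_n=e^{i\pi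 n/p}$, $e_n=\frac1{2p}(\tau_n^{2m})_{m=1}^p\in\mathbb C^p$, $v^0=(v_{2m})_{m=1}^p$, $v^1=(v_{2m-1})_{m=1}^p$, and $\hat v_n^j=\langle v^j,e_n\rangle=\frac1{2p}\sum_{m=1}^p v^j_m\,\overline{\tau_n^{2m}}$ for $j=0,1$ and $1\le n\le 2p-1$. Let $\ell_{0,p_*}^{per}$ be the set of real $p_*$-periodic $v$ with $\sum_{n=1}^{2p}v_n=0$, and let $\mathfrak X_{p_*}$ be the set of $v\in\ell_{0,p_*}^{per}$ such that * if $p_*$ is even: $\hat v_n^0+\hat v_n^1\ne0$ and $\hat v_n^0\hat v_n^1=0$ for all $1\le n\le p-1$, and $\hat v_p^0\neq0$; * if $p_*$ is odd: $\hat v_n^0\ne0$ for all $1\le n\le p-1$. Put $\psi_{k,n}(v)=|\hat v_n^0+e^{2i\arg(2|c_k|+\tau_n)}\hat v_n^1|$ for $1\le n\le 2p-1$, $n\ne p$, and, if $2|c_k|=1$, $\psi_{k,p}(v)=|\hat v_p^0-\hat v_p^1|$. Put $\mathbb N_{k,p}=\{1,\dots,2p-1\}$ if $2|c_k|=1$ and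 $\mathbb N_{k,p}=\{1,\dots,2p-1\}\setminus\{p\}$ if $2|c_k|\neq1$. **Proposition.** i) $\mathfrak X_{p_*}\neq\emptyset$ for every $p_*\ge2$. ii) Let $p_*$ be even and $v\in\mathfrak X_{p_*}$. For every $n\in\mathbb N_{k,p}$, as $t\downarrow0$, $$z_{k,n}^{b,\pm}(t)=z_{k,n}^{b,\pm}(0)\pm t\,\xi_n+O(t^2),\qquad \xi_n=\begin{cases}|\hat v_n^0+\hat v_n^1|,& n\ne p,\\ |\hat v_p^0-\hat v_p^1|,& n=p,\end{cases}\qquad \xi_n>0,$$ and the gap length is $z_{k,n}^{b,+}(t)-z_{k,n}^{b,-}(t)=2t\,\xi_n+O(t^2)$. Here, for $n\neq p$, $\xi_n=|\hat v_n^j|$ for some $j\in\{0,1\}$ with $\hat v_n^j\ne0$, while for $n=p$ (which occurs only if $2|c_k|=1$), $\xi_p=2|\hat v_p^0|=2|\hat v_p^1|$. iii) Let $p_*$ be odd and $v\in\mathfrak X_{p_*}$. * If $2|c_k|\ne1$, then $\psi_{k,n}(v)\ne0$ for all $n\in\{1,\dots,2p-1\}\setminus\{p\}$, and there is $t_0>0$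 such that $\gamma_{k,n}^b(t)\ne\emptyset$ for all these $n$ and all $0<t<t_0$. * If $2|c_k|=1$, then, for $n\in\{1,\dots,2p-1\}$, $\psi_{k,n}(v)\neq0$ for even $n$ and $\psi_{k,n}(v)=0$ for odd $n$, and there is $t_0>0$ such that $\gamma_{k,n}^b(t)\neq\emptyset$ for all even $n\in\{1,\dots,2p-1\}$ and all $0<t<t_0$. -/

import Mathlib

namespace Nanotube

/-- The number `p` attached to the period `ps` of the potential: `ps / 2` for even `ps`, and `ps`
for odd `ps`.  In both cases `2 * p` is a common period of the potential and of the weights. -/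
def halfPeriod (ps : ℕ) : ℕ := if Even ps then ps / 2 else ps

/-- `c_k = cos (b + π k / N)`; the integer `k` represents a class modulo `N`
(and `|c_k|` depends only on that class). -/
noncomputable def ck (N : ℕ) (b : ℝ) (k : ℤ) : ℝ := Real.cos (b + Real.pi * k / N)

/-- The weights of the Jacobi operator: `a_{2n} = a`, `a_{2n+1} = 1`. -/
noncomputable def weight (a : ℝ) (n : ℤ) : ℝ := if Even n then a else 1

/-- The action of the Jacobi operator with weights `a_{2n} = a`, `a_{2n+1} = 1` and potential `v`
on a sequence `y`; `J_k^b` is the case `a = 2 |c_k|`, and `J_k^b(t)` has `t • v` in place of `v`. -/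
noncomputable def jacobi (a : ℝ) (v y : ℤ → ℝ) (n : ℤ) : ℝ :=
  weight a (n - 1) * y (n - 1) + weight a n * y (n + 1) + v n * y n

/-- The matrix of the Jacobi operator on `4p`-periodic sequences, in the basis formed by the
`4p`-periodic extensions of the unit vectors at `0, …, 4p - 1`. -/
noncomputable def periodicMatrix (p : ℕ) (a : ℝ) (v : ℤ → ℝ) :
    Matrix (Fin (4 * p)) (Fin (4 * p)) ℝ :=
  Matrix.of fun i j =>
    jacobi a v (fun n => if n % ((4 * p : ℕ) : ℤ) = ((j : ℕ) : ℤ) then 1 else 0) ((i : ℕ) : ℤ)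

/-- The `4p`-periodic eigenvalues in increasing order, repeated according to multiplicity and
numbered from `0` to `4p - 1`. -/
noncomputable def periodicEigenvalue (p : ℕ) (a : ℝ) (v : ℤ → ℝ) (r : ℕ) : ℝ :=
  ((periodicMatrix p a v).charpoly.roots.sort (· ≤ ·)).getD r 0

/-- The band edge `z_n^-`, `1 ≤ n ≤ 2p`, in the numbering
`z_0^+ < z_1^- ≤ z_1^+ < z_2^- ≤ z_2^+ < … < z_{2p}^-` of the `4p`-periodic eigenvalues. -/
noncomputable def edgeMinus (p : ℕ) (a : ℝ) (v : ℤ → ℝ) (n : ℕ) : ℝ :=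
  periodicEigenvalue p a v (2 * n - 1)

/-- The band edge `z_n^+`, `0 ≤ n ≤ 2p - 1`, in the same numbering. -/
noncomputable def edgePlus (p : ℕ) (a : ℝ) (v : ℤ → ℝ) (n : ℕ) : ℝ :=
  periodicEigenvalue p a v (2 * n)

/-- The gap `γ_n = (z_n^-, z_n^+)`, `1 ≤ n ≤ 2p - 1`. -/
def gap (p : ℕ) (a : ℝ) (v : ℤ → ℝ) (n : ℕ) : Set ℝ :=
  Set.Ioo (edgeMinus p a v n) (edgePlus p a v n)

/-- `τ_n = exp (iπn/p)`. -/
noncomputable def tau (p n : ℕ) : ℂ := Complex.exp (Complex.I * Real.pi * n / p)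

/-- The entries `(e_n)_m = τ_n^{2m} / (2p)`, `1 ≤ m ≤ p`, of the vector `e_n ∈ ℂ^p`. -/
noncomputable def fourierVec (p n m : ℕ) : ℂ := 1 / (2 * p) * tau p n ^ (2 * m)

/-- The Fourier coefficient `⟨v^j, e_n⟩` (linear in the first argument) of the vectors
`v^0 = (v_{2m})_{m=1}^p` and `v^1 = (v_{2m-1})_{m=1}^p`. -/
noncomputable def hat (p : ℕ) (v : ℤ → ℝ) (j : Fin 2) (n : ℕ) : ℂ :=
  ∑ m ∈ Finset.Icc 1 p,
    (v (2 * (m : ℤ) - ((j : ℕ) : ℤ)) : ℂ) * (starRingEnd ℂ) (fourierVec p n m)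

/-- Real `ps`-periodic sequences with `v_1 + … + v_{2p} = 0`. -/
def zeroMeanPeriodic (ps : ℕ) : Set (ℤ → ℝ) :=
  {v | (∀ n, v (n + ps) = v n) ∧ ∑ n ∈ Finset.Icc 1 (2 * halfPeriod ps), v (n : ℤ) = 0}

/-- The set `𝔛_{ps}` of potentials. -/
def frakX (ps : ℕ) : Set (ℤ → ℝ) :=
  {v | v ∈ zeroMeanPeriodic ps ∧
    (Even ps →
      (∀ n, 1 ≤ n → n < halfPeriod ps →
        hat (halfPeriod ps) v 0 n + hat (halfPeriod ps) v 1 n ≠ 0 ∧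
        hat (halfPeriod ps) v 0 n * hat (halfPeriod ps) v 1 n = 0) ∧
      hat (halfPeriod ps) v 0 (halfPeriod ps) ≠ 0) ∧
    (Odd ps → ∀ n, 1 ≤ n → n < halfPeriod ps → hat (halfPeriod ps) v 0 n ≠ 0)}

/-- `{1, …, 2p - 1}` if `a = 1`, and `{1, …, 2p - 1} \ {p}` if `a ≠ 1`, where `a = 2 |c_k|`. -/
def gapIndices (p : ℕ) (a : ℝ) : Set ℕ := {n | 1 ≤ n ∧ n < 2 * p ∧ (n = p → a = 1)}

/-- `ψ_{k,n}(v)` as a function of `a = 2 |c_k|`.  (For `n = p` it is used only when `a = 1`.) -/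
noncomputable def psi (p : ℕ) (a : ℝ) (v : ℤ → ℝ) (n : ℕ) : ℝ :=
  if n = p then ‖hat p v 0 n - hat p v 1 n‖
  else ‖hat p v 0 n
    + Complex.exp (2 * Complex.I * Complex.arg ((a : ℂ) + tau p n)) * hat p v 1 n‖

/-- `ξ_n(v) = |v̂_n^0 + v̂_n^1|` for `n ≠ p`, and `ξ_p(v) = |v̂_p^0 - v̂_p^1|`. -/
noncomputable def xi (p : ℕ) (v : ℤ → ℝ) (n : ℕ) : ℝ :=
  if n = p then ‖hat p v 0 n - hat p v 1 n‖ else ‖hat p v 0 n + hat p v 1 n‖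

end Nanotube

/-! At `t = 0` the weights have period 2, and Bloch functions with multipliers `τ_m`, `0 ≤ m < 2p`,
diagonalize the operator on `4p`-periodic sequences, with eigenvalues `±|a + τ_m|`. Since `|a + τ_m|
= |a + τ_{2p-m}|`, the eigenvalues with `m ≠ 0, p` are double, while the two with `m = p` meet (at
0) exactly when `a = 1`. So every index in `gapIndices` belongs to a double eigenvalue, and counting
the eigenvalues below it gives its place in the increasing order.

In the Bloch basis the perturbation is `tV`. The zero mean of `v` kills the diagonal of `V`, so a
double eigenvalue `μ` with basis vectors `i`, `j` splits into `μ ± t‖V i j‖ + O(t²)`. This is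
`exists_abs_sort_eigenvalues_sub_le`, proved by min-max: a bound of the quadratic form on a subspace
of small codimension forces many eigenvalues below a level, and the same argument for the negated
matrix gives the opposite bounds. `exists_abs_edge_sub_le` transfers the result to band edges.

The number `‖V i j‖` is `coupling`, a combination of the two Fourier coefficients with a phase
between them. For even period one coefficient vanishes when `n ≠ p`, so the phase is invisible and
`coupling` equals `xi`. For odd period the odd sites carry a cyclic shift of the even sites, so one
coefficient is an explicit multiple of the other (`hat_one_eq_of_odd`). Then, for `n ≠ p`,
`coupling` equals `psi`, and by `one_add_bandPhase_sq_mul` it is `|v̂_n^0|` times a factor vanishing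
only for `a = 1` and `n` odd. -/

/-! ### Eigenvalue counting by quadratic forms -/

open Matrix Finset in
/-- If the quadratic form of `H = U diag(e) Uᴴ` is at most `c` on the kernel of `L`, then at most
`card κ` of the eigenvalues exceed `c`. -/
theorem card_le_card_add_card_le_of_form_le {ι κ : Type*} [Fintype ι] [DecidableEq ι] [Fintype κ]
    {U H : Matrix ι ι ℂ} (hU : U * Uᴴ = 1) {e : ι → ℝ}
    (hH : H = U * diagonal (fun i => (e i : ℂ)) * Uᴴ) (L : (ι → ℂ) →ₗ[ℂ] (κ → ℂ)) {c : ℝ}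
    (hform : ∀ x, L x = 0 → (star x ⬝ᵥ H *ᵥ x).re ≤ c * ∑ i, ‖x i‖ ^ 2) :
    Fintype.card ι ≤ Fintype.card κ + #{i | e i ≤ c} := by
  by_contra! hlt
  -- If the count fails, `M` has a nonzero kernel vector: it lies in the kernel of `L` and is
  -- orthogonal to all eigenvectors with eigenvalue at most `c`, so its form exceeds `c` times its
  -- squared norm.
  let M : (ι → ℂ) →ₗ[ℂ] (κ → ℂ) × ({i // e i ≤ c} → ℂ) :=
    L.prod (LinearMap.pi fun i => LinearMap.proj (i : ι) ∘ₗ Matrix.mulVecLin Uᴴ)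
  have hM : LinearMap.ker M ≠ ⊥ := by
    apply LinearMap.ker_ne_bot_of_finrank_lt
    simpa [Fintype.card_subtype] using hlt
  obtain ⟨x, hxM, hx0⟩ := (Submodule.ne_bot_iff _).1 hM
  have hx : L x = 0 ∧ (fun i : {i // e i ≤ c} => (Uᴴ *ᵥ x) i) = 0 := by
    simpa [M, LinearMap.prod_apply, Prod.ext_iff, LinearMap.pi, funext_iff] using hxM
  obtain ⟨hL, hy0⟩ := hx
  set y := Uᴴ *ᵥ x with hy
  have hxy : U *ᵥ y = x := by rw [hy, mulVec_mulVec, hU, one_mulVec]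
  have hyx : star y = star x ᵥ* U := by rw [hy, star_mulVec, conjTranspose_conjTranspose]
  have hform1 : (star x ⬝ᵥ H *ᵥ x).re = ∑ i, e i * ‖y i‖ ^ 2 := by
    rw [hH, ← mulVec_mulVec, ← mulVec_mulVec, ← hy, dotProduct_mulVec, ← hyx]
    simp only [dotProduct, mulVec_diagonal, Complex.re_sum, Pi.star_apply]
    refine sum_congr rfl fun i _ => ?_
    rw [← mul_assoc, mul_comm (star (y i)), mul_assoc, RCLike.star_def, Complex.conj_mul',
      ← Complex.ofReal_pow, ← Complex.ofReal_mul, Complex.ofReal_re]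
  have hsq : ∀ z : ι → ℂ, star z ⬝ᵥ z = ((∑ i, ‖z i‖ ^ 2 : ℝ) : ℂ) := by
    intro z
    simp [dotProduct, Complex.conj_mul']
  have hnorm : ∑ i, ‖x i‖ ^ 2 = ∑ i, ‖y i‖ ^ 2 := by
    have h : star x ⬝ᵥ x = star y ⬝ᵥ y := by
      rw [hyx, ← dotProduct_mulVec, hxy]
    rw [hsq, hsq] at h
    exact_mod_cast h
  have h1 := hform x hL
  rw [hform1, hnorm, mul_sum] at h1
  have hyne : y ≠ 0 := by
    intro h
    rw [h, mulVec_zero] at hxy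
    exact hx0 hxy.symm
  obtain ⟨i₀, hi₀⟩ := Function.ne_iff.1 hyne
  have key : ∀ i, c * ‖y i‖ ^ 2 ≤ e i * ‖y i‖ ^ 2 := by
    intro i
    by_cases hi : e i ≤ c
    · have := congrFun hy0 ⟨i, hi⟩
      simp only [Pi.zero_apply] at this
      simp [this]
    · gcongr
      exact (not_le.1 hi).le
  refine absurd h1 (not_le.2 (sum_lt_sum (fun i _ => key i) ⟨i₀, mem_univ _, ?_⟩))
  have hi : c < e i₀ := by
    by_contra! hi
    exact hi₀ (congrFun hy0 ⟨i₀, hi⟩)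
  have : 0 < ‖y i₀‖ := norm_pos_iff.2 hi₀
  gcongr

/-! ### From eigenvalue counts to entries of a sorted list -/

theorem List.Pairwise.getD_le_of_lt_length_filter {l : List ℝ} (hl : l.Pairwise (· ≤ ·)) {x : ℝ}
    {r : ℕ} (hr : r < (l.filter (· ≤ x)).length) : l.getD r 0 ≤ x := by
  induction l generalizing r with
  | nil => simp at hr
  | cons h t ih =>
    rw [List.pairwise_cons] at hl
    by_cases hx : h ≤ x
    · cases r with
      | zero => simpa using hx
      | succ r =>
        simp only [List.getD_cons_succ]
        exact ih hl.2 (by simpa [hx] using hr)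
    · have : (h :: t).filter (· ≤ x) = [] := by
        simp only [List.filter_eq_nil_iff, List.mem_cons, decide_eq_true_eq, not_le]
        rintro a (rfl | ha)
        · exact not_le.1 hx
        · exact (not_le.1 hx).trans_le (hl.1 a ha)
      simp [this] at hr

/-- Here `r < l.length` has to be assumed: beyond the end the counting condition is trivial and
`getD` returns the default 0. In the companion upper bound the count itself keeps `r` in range. -/
theorem List.Pairwise.le_getD_of_length_filter_le {l : List ℝ} (hl : l.Pairwise (· ≤ ·)) {x : ℝ}
    {r : ℕ} (hr : r < l.length) (hle : l.length ≤ (l.filter (x ≤ ·)).length + r) :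
    x ≤ l.getD r 0 := by
  induction l generalizing r with
  | nil => simp at hr
  | cons h t ih =>
    rw [List.pairwise_cons] at hl
    cases r with
    | zero =>
      have h1 : (h :: t).filter (x ≤ ·) = h :: t :=
        List.filter_sublist.eq_of_length_le (by simpa using hle)
      have := List.filter_eq_self.1 h1 h (by simp)
      simpa using this
    | succ r =>
      simp only [List.getD_cons_succ]
      by_cases hx : x ≤ h
      · have hr' : r < t.length := by simpa using hr
        rw [List.getD_eq_getElem _ _ hr']
        exact hx.trans (hl.1 _ (List.getElem_mem _))
      · refine ih hl.2 (by simpa using hr) ?_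
        simp only [List.length_cons, List.filter_cons, hx, decide_false, Bool.false_eq_true,
          if_false] at hle
        omega

open Finset in
theorem sort_getD_le {ι : Type*} [Fintype ι] {e : ι → ℝ} {x : ℝ} {r : ℕ}
    (hr : r < #{i | e i ≤ x}) : ((univ.val.map e).sort (· ≤ ·)).getD r 0 ≤ x := by
  refine List.Pairwise.getD_le_of_lt_length_filter (Multiset.pairwise_sort _ _) ?_
  have : ((((univ.val.map e).sort (· ≤ ·)).filter (· ≤ x) : List ℝ) : Multiset ℝ)
      = (univ.val.filter (fun i => e i ≤ x)).map e := by
    rw [← Multiset.filter_coe, Multiset.sort_eq, Multiset.filter_map]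
    rfl
  rwa [← Multiset.coe_card, this, Multiset.card_map]

open Finset in
theorem le_sort_getD {ι : Type*} [Fintype ι] {e : ι → ℝ} {x : ℝ} {r : ℕ}
    (hr : r < Fintype.card ι) (hle : Fintype.card ι ≤ #{i | x ≤ e i} + r) :
    x ≤ ((univ.val.map e).sort (· ≤ ·)).getD r 0 := by
  have hlen : ((univ.val.map e).sort (· ≤ ·)).length = Fintype.card ι := by
    simp
  refine List.Pairwise.le_getD_of_length_filter_le (Multiset.pairwise_sort _ _) (by rwa [hlen]) ?_
  have : ((((univ.val.map e).sort (· ≤ ·)).filter (x ≤ ·) : List ℝ) : Multiset ℝ)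
      = (univ.val.filter (fun i => x ≤ e i)).map e := by
    rw [← Multiset.filter_coe, Multiset.sort_eq, Multiset.filter_map]
    rfl
  rwa [hlen, ← Multiset.coe_card, this, Multiset.card_map]

/-! ### First-order splitting of a double eigenvalue -/

-- The sum of the moduli of the entries serves as a crude operator norm; only the constant in the
-- `O(t²)` term depends on it.
open Matrix Finset in
theorem norm_dotProduct_mulVec_le {ι : Type*} [Fintype ι] (V : Matrix ι ι ℂ) (x y : ι → ℂ) :
    ‖star x ⬝ᵥ V *ᵥ y‖
      ≤ (∑ k, ∑ l, ‖V k l‖) * √(∑ k, ‖x k‖ ^ 2) * √(∑ k, ‖y k‖ ^ 2) := by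
  have hle : ∀ (z : ι → ℂ) k, ‖z k‖ ≤ √(∑ k, ‖z k‖ ^ 2) := fun z k =>
    Real.le_sqrt_of_sq_le
      (single_le_sum (f := fun k => ‖z k‖ ^ 2) (fun _ _ => by positivity) (mem_univ k))
  calc ‖star x ⬝ᵥ V *ᵥ y‖ ≤ ∑ k, ∑ l, ‖x k‖ * (‖V k l‖ * ‖y l‖) := by
        refine (norm_sum_le _ _).trans (sum_le_sum fun k _ => ?_)
        rw [norm_mul, ← mul_sum, Pi.star_apply, norm_star]
        gcongr
        refine (norm_sum_le _ _).trans (sum_le_sum fun l _ => ?_)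
        rw [norm_mul]
    _ ≤ ∑ k, ∑ l, √(∑ k, ‖x k‖ ^ 2) * (‖V k l‖ * √(∑ k, ‖y k‖ ^ 2)) := by
        gcongr <;> apply hle
    _ = _ := by
        simp only [sum_mul]
        refine sum_congr rfl fun k _ => sum_congr rfl fun l _ => by ring

open Matrix Finset in
/-- First order upper bound for the quadratic form of `diag(d) + tV` on the spectral subspace
below a double eigenvalue `μ = d i = d j` of `diag(d)`. -/
theorem form_le_of_double {ι : Type*} [Fintype ι] [DecidableEq ι] {d : ι → ℝ} {V : Matrix ι ι ℂ}
    (hV : V.IsHermitian) {i j : ι} (hij : i ≠ j) {μ g η K t : ℝ} (hi : d i = μ) (hj : d j = μ)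
    (hg : 0 < g) (hlow : ∀ k, k ≠ i → k ≠ j → d k ≤ μ → d k ≤ μ - g)
    (hVi : V i i = 0) (hVj : V j j = 0) (hK : ∑ k, ∑ l, ‖V k l‖ ≤ K) (hη : |η| ≤ K)
    (ht : 0 ≤ t) (htg : 4 * K * t ≤ g) {x : ι → ℂ} (hx : ∀ k, μ < d k → x k = 0)
    (hxη : 2 * (star (x i) * V i j * x j).re ≤ η * (‖x i‖ ^ 2 + ‖x j‖ ^ 2)) :
    (star x ⬝ᵥ (diagonal (fun k => (d k : ℂ)) + (t : ℂ) • V) *ᵥ x).re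
      ≤ (μ + t * η + 2 * K ^ 2 / g * t ^ 2) * ∑ k, ‖x k‖ ^ 2 := by
  -- `f` is the component in the double eigenspace. The remainder `l` lives on eigenvalues at most
  -- `μ - g`, because `x` vanishes above `μ`.
  set f : ι → ℂ := Pi.single i (x i) + Pi.single j (x j) with hf
  set l : ι → ℂ := x - f with hl
  have hxlf : x = l + f := by simp [hl]
  have hfi : f i = x i := by simp [hf, hij]
  have hfj : f j = x j := by simp [hf, hij.symm]
  have hfk : ∀ k, k ≠ i → k ≠ j → f k = 0 := fun k h1 h2 => by simp [hf, h1, h2]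
  have hK0 : 0 ≤ K := (abs_nonneg η).trans hη
  set X := √(∑ k, ‖l k‖ ^ 2)
  set Y := √(∑ k, ‖f k‖ ^ 2)
  have hX : X ^ 2 = ∑ k, ‖l k‖ ^ 2 := Real.sq_sqrt (sum_nonneg fun _ _ => by positivity)
  have hY : Y ^ 2 = ∑ k, ‖f k‖ ^ 2 := Real.sq_sqrt (sum_nonneg fun _ _ => by positivity)
  have hX0 : 0 ≤ X := Real.sqrt_nonneg _
  have hY0 : 0 ≤ Y := Real.sqrt_nonneg _
  have hYf : Y ^ 2 = ‖x i‖ ^ 2 + ‖x j‖ ^ 2 := by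
    rw [hY, ← sum_subset (subset_univ {i, j}), sum_pair hij, hfi, hfj]
    intro k _ hk
    simp only [mem_insert, mem_singleton, not_or] at hk
    simp [hfk k hk.1 hk.2]
  have hsum : ∑ k, ‖x k‖ ^ 2 = X ^ 2 + Y ^ 2 := by
    rw [hX, hY, ← sum_add_distrib]
    refine sum_congr rfl fun k _ => ?_
    by_cases h1 : k = i
    · subst h1; simp [hl, hfi]
    by_cases h2 : k = j
    · subst h2; simp [hl, hfj]
    simp [hl, hfk k h1 h2]
  have hdiag : ∑ k, d k * ‖x k‖ ^ 2 ≤ (μ - g) * X ^ 2 + μ * Y ^ 2 := by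
    rw [hX, hY, mul_sum, mul_sum, ← sum_add_distrib]
    refine sum_le_sum fun k _ => ?_
    by_cases h1 : k = i
    · subst h1; simp [hl, hfi, hi]
    by_cases h2 : k = j
    · subst h2; simp [hl, hfj, hj]
    by_cases h3 : d k ≤ μ
    · simp only [hl, Pi.sub_apply, hfk k h1 h2, sub_zero, norm_zero, ne_eq, OfNat.ofNat_ne_zero,
        not_false_eq_true, zero_pow, mul_zero, add_zero]
      gcongr
      exact hlow k h1 h2 h3
    · simp [hl, hfk k h1 h2, hx k (not_le.1 h3)]
  have hbound : ∀ y z : ι → ℂ, (star y ⬝ᵥ V *ᵥ z).re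
      ≤ K * √(∑ k, ‖y k‖ ^ 2) * √(∑ k, ‖z k‖ ^ 2) := fun y z =>
    (Complex.re_le_norm _).trans ((norm_dotProduct_mulVec_le V y z).trans (by gcongr))
  have hff : (star f ⬝ᵥ V *ᵥ f).re ≤ η * Y ^ 2 := by
    refine le_of_eq_of_le ?_ (hxη.trans_eq (by rw [hYf]))
    have hVji : V j i = star (V i j) := (hV.apply j i).symm
    have : star f ⬝ᵥ V *ᵥ f = star (x i) * V i j * x j + star (star (x i) * V i j * x j) := by
      rw [hf, star_add, mulVec_add, mulVec_single, mulVec_single, add_dotProduct,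
        ← Pi.single_star, ← Pi.single_star, single_dotProduct, single_dotProduct]
      simp [hVi, hVj, hVji]
      ring
    rw [this, Complex.add_re, RCLike.star_def, Complex.conj_re]
    ring
  have hform : (star x ⬝ᵥ (diagonal (fun k => (d k : ℂ)) + (t : ℂ) • V) *ᵥ x).re
      = ∑ k, d k * ‖x k‖ ^ 2 + t * (star x ⬝ᵥ V *ᵥ x).re := by
    rw [add_mulVec, dotProduct_add, Complex.add_re, smul_mulVec, dotProduct_smul]
    congr 1
    · simp only [dotProduct, mulVec_diagonal, Complex.re_sum, Pi.star_apply]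
      refine sum_congr rfl fun i _ => ?_
      rw [← mul_assoc, mul_comm (star (x i)), mul_assoc, RCLike.star_def, Complex.conj_mul',
        ← Complex.ofReal_pow, ← Complex.ofReal_mul, Complex.ofReal_re]
    · simp
  have hVx : (star x ⬝ᵥ V *ᵥ x).re ≤ K * X * X + 2 * (K * X * Y) + η * Y ^ 2 := by
    have e : star x ⬝ᵥ V *ᵥ x = star l ⬝ᵥ V *ᵥ l + star l ⬝ᵥ V *ᵥ f + star f ⬝ᵥ V *ᵥ l
        + star f ⬝ᵥ V *ᵥ f := by
      rw [hxlf, star_add, mulVec_add, add_dotProduct, dotProduct_add, dotProduct_add]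
      ring
    rw [e]
    simp only [Complex.add_re]
    have h1 := hbound l l
    have h2 := hbound l f
    have h3 := hbound f l
    simp only [X, Y] at *
    linarith
  rw [hform, hsum]
  have hη' := neg_le_of_abs_le hη
  have h2 : t * (star x ⬝ᵥ V *ᵥ x).re ≤ t * (K * X * X + 2 * (K * X * Y) + η * Y ^ 2) := by gcongr
  -- The gain `-g X²` from the spectral gap is spent in two halves. This half absorbs the cross
  -- terms by completing a square, which produces the error constant `2K²/g`; the other half pays
  -- for `tKX²` and for replacing `Y²` by `X² + Y²` next to `tη`, which is where `4Kt ≤ g` enters.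
  have h3 : 2 * t * K * X * Y ≤ g / 2 * X ^ 2 + 2 * K ^ 2 / g * t ^ 2 * Y ^ 2 := by
    have : g / 2 * X ^ 2 + 2 * K ^ 2 / g * t ^ 2 * Y ^ 2 - 2 * t * K * X * Y
        = (g * X - 2 * K * t * Y) ^ 2 / (2 * g) := by field_simp; ring
    have : 0 ≤ (g * X - 2 * K * t * Y) ^ 2 / (2 * g) := by positivity
    linarith
  have h4 : (2 * K * t) * X ^ 2 ≤ g / 2 * X ^ 2 := by gcongr; linarith
  have h5 : t * (-K) * X ^ 2 ≤ t * η * X ^ 2 := by gcongr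
  have h6 : 0 ≤ 2 * K ^ 2 / g * t ^ 2 * X ^ 2 := by positivity
  nlinarith

open Matrix Finset in
theorem card_eigenvalues_le_of_double {ι : Type*} [Fintype ι] [DecidableEq ι] {d : ι → ℝ}
    {V : Matrix ι ι ℂ} (hV : V.IsHermitian) {i j : ι} (hij : i ≠ j) {μ g K t : ℝ}
    (hi : d i = μ) (hj : d j = μ) (hg : 0 < g)
    (hlow : ∀ k, k ≠ i → k ≠ j → d k ≤ μ → d k ≤ μ - g)
    (hVi : V i i = 0) (hVj : V j j = 0) (hK : ∑ k, ∑ l, ‖V k l‖ ≤ K)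
    (ht : 0 ≤ t) (htg : 4 * K * t ≤ g) {U : Matrix ι ι ℂ} {e : ι → ℝ} (hU : U * Uᴴ = 1)
    (hH : diagonal (fun k => (d k : ℂ)) + (t : ℂ) • V
      = U * diagonal (fun i => (e i : ℂ)) * Uᴴ) :
    Fintype.card ι ≤ #{k | μ < d k} + 1
        + #{k | e k ≤ μ - t * ‖V i j‖ + 2 * K ^ 2 / g * t ^ 2} ∧
    Fintype.card ι ≤ #{k | μ < d k}
        + #{k | e k ≤ μ + t * ‖V i j‖ + 2 * K ^ 2 / g * t ^ 2} := by
  have hVK : ‖V i j‖ ≤ K :=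
    ((single_le_sum (f := fun l => ‖V i l‖) (fun _ _ => norm_nonneg _) (mem_univ j)).trans
      (single_le_sum (f := fun k => ∑ l, ‖V k l‖)
        (fun _ _ => sum_nonneg fun _ _ => norm_nonneg _) (mem_univ i))).trans hK
  constructor
  -- On the line `x i = ω x j` the form of `V` takes its least value `-‖V i j‖` relative to the
  -- squared norm. Imposing this relation costs one extra linear condition, the `none` of the
  -- `Option` index below.
  · obtain ⟨ω, hω, hωV⟩ : ∃ ω : ℂ, ‖ω‖ = 1 ∧ star ω * V i j = -‖V i j‖ := by
      by_cases h0 : V i j = 0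
      · exact ⟨1, by simp, by simp [h0]⟩
      · have hne : (‖V i j‖ : ℂ) ≠ 0 := by simpa using h0
        refine ⟨-(V i j / ‖V i j‖), by simp [h0], ?_⟩
        simp only [star_neg, star_div₀, RCLike.star_def, Complex.conj_ofReal]
        rw [neg_mul, div_mul_eq_mul_div, Complex.conj_mul']
        field_simp
    have := card_le_card_add_card_le_of_form_le hU hH
      (LinearMap.pi fun o : Option {k // μ < d k} =>
        o.elim (LinearMap.proj i - ω • LinearMap.proj j) fun k => LinearMap.proj (k : ι))
      (c := μ + t * (-‖V i j‖) + 2 * K ^ 2 / g * t ^ 2) (fun x hx => by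
        have hx1 : x i = ω * x j := by
          have := congrFun hx none
          simpa [sub_eq_zero] using this
        refine form_le_of_double hV hij hi hj hg hlow hVi hVj hK
          (by rwa [abs_neg, abs_norm]) ht htg (fun k hk => ?_) ?_
        · have := congrFun hx (some ⟨k, hk⟩)
          simpa using this
        · have : star (x i) * V i j * x j = ((-‖V i j‖ * ‖x j‖ ^ 2 : ℝ) : ℂ) := by
            calc star (x i) * V i j * x j = star ω * V i j * (star (x j) * x j) := by
                  rw [hx1, star_mul']
                  ring
              _ = _ := by
                  rw [hωV, RCLike.star_def, Complex.conj_mul']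
                  push_cast
                  ring
          rw [this, Complex.ofReal_re, hx1, norm_mul, hω]
          apply le_of_eq
          ring)
    rw [Fintype.card_option, Fintype.card_subtype] at this
    simpa [sub_eq_add_neg] using this
  · have := card_le_card_add_card_le_of_form_le hU hH
      (LinearMap.pi fun k : {k // μ < d k} => LinearMap.proj (k : ι))
      (c := μ + t * ‖V i j‖ + 2 * K ^ 2 / g * t ^ 2) (fun x hx => by
        refine form_le_of_double hV hij hi hj hg hlow hVi hVj hK
          (by rwa [abs_norm]) ht htg (fun k hk => congrFun hx ⟨k, hk⟩) ?_
        refine (mul_le_mul_of_nonneg_left (Complex.re_le_norm _) (by norm_num)).trans ?_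
        rw [norm_mul, norm_mul, norm_star]
        nlinarith [mul_nonneg (norm_nonneg (V i j)) (sq_nonneg (‖x i‖ - ‖x j‖))])
    rw [Fintype.card_subtype] at this
    exact this

open Matrix Finset in
/-- Splitting of a double eigenvalue `μ = d i = d j` under `diag(d) + tV`, `V i i = V j j = 0`:
the two perturbed eigenvalues are `μ ± t ‖V i j‖ + O(t ^ 2)`. -/
theorem exists_abs_sort_eigenvalues_sub_le {ι : Type*} [Fintype ι] [DecidableEq ι] {d : ι → ℝ}
    {V : Matrix ι ι ℂ} (hV : V.IsHermitian) {i j : ι} (hij : i ≠ j) {μ : ℝ}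
    (hi : d i = μ) (hj : d j = μ) (hne : ∀ k, k ≠ i → k ≠ j → d k ≠ μ)
    (hVi : V i i = 0) (hVj : V j j = 0) {r : ℕ} (hr : #{k | d k < μ} = r) :
    ∃ C t₀ : ℝ, 0 < t₀ ∧ ∀ t : ℝ, 0 ≤ t → t ≤ t₀ → ∀ {U : Matrix ι ι ℂ} {e : ι → ℝ}
      (_ : U * Uᴴ = 1) (_ : diagonal (fun k => (d k : ℂ)) + (t : ℂ) • V
        = U * diagonal (fun i => (e i : ℂ)) * Uᴴ),
      |((univ.val.map e).sort (· ≤ ·)).getD r 0 - (μ - t * ‖V i j‖)| ≤ C * t ^ 2 ∧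
      |((univ.val.map e).sort (· ≤ ·)).getD (r + 1) 0 - (μ + t * ‖V i j‖)| ≤ C * t ^ 2 := by
  obtain ⟨g, hg, hgap⟩ : ∃ g : ℝ, 0 < g ∧ ∀ k, k ≠ i → k ≠ j → g ≤ |d k - μ| := by
    have : ∀ k, ∃ g : ℝ, 0 < g ∧ (k ≠ i → k ≠ j → g ≤ |d k - μ|) := by
      intro k
      by_cases h : k ≠ i ∧ k ≠ j
      · exact ⟨|d k - μ|, abs_pos.2 (sub_ne_zero.2 (hne k h.1 h.2)), fun _ _ => le_rfl⟩
      · exact ⟨1, one_pos, fun h1 h2 => absurd ⟨h1, h2⟩ h⟩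
    choose G hG0 hG using this
    have hne' : (univ : Finset ι).Nonempty := ⟨i, mem_univ i⟩
    refine ⟨univ.inf' hne' G, (lt_inf'_iff _).2 fun k _ => hG0 k, fun k h1 h2 => ?_⟩
    exact (inf'_le _ (mem_univ k)).trans (hG k h1 h2)
  set K := ∑ k, ∑ l, ‖V k l‖ with hKdef
  have hK0 : 0 ≤ K := sum_nonneg fun _ _ => sum_nonneg fun _ _ => norm_nonneg _
  -- The `+ 1` keeps the denominator positive when `V = 0`.
  refine ⟨2 * K ^ 2 / g, g / (4 * K + 1), by positivity, fun t ht htt U e hU hH => ?_⟩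
  have htg : 4 * K * t ≤ g := by
    rw [le_div_iff₀ (by positivity)] at htt
    nlinarith
  have hN : Fintype.card ι = #{k | μ < d k} + r + 2 := by
    rw [← hr, ← card_univ, ← card_filter_add_card_filter_not (s := univ) (fun k => μ < d k),
      add_assoc]
    congr 1
    have : (univ.filter fun k => ¬ μ < d k) = (univ.filter fun k => d k < μ) ∪ {i, j} := by
      ext k
      simp only [mem_filter, mem_univ, true_and, not_lt, mem_union, mem_insert, mem_singleton]
      constructor
      · intro h
        rcases h.lt_or_eq with h | h
        · exact Or.inl h
        · right
          by_contra! h'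
          exact hne k h'.1 h'.2 h
      · rintro (h | rfl | rfl)
        · exact h.le
        · exact hi.le
        · exact hj.le
    rw [this, card_union_of_disjoint, card_pair hij]
    rw [disjoint_right]
    intro k hk
    simp only [mem_insert, mem_singleton] at hk
    rcases hk with rfl | rfl <;> simp [hi, hj]
  obtain ⟨h1, h2⟩ := card_eigenvalues_le_of_double hV hij hi hj hg
    (fun k hk1 hk2 hk => by
      have := hgap k hk1 hk2
      rw [abs_of_nonpos (by linarith)] at this
      linarith) hVi hVj (K := K) le_rfl ht htg hU hH
  -- Upper counts for `-H` are lower counts for `H`. The eigenvalues of `-d` above `-μ` are those of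
  -- `d` below `μ`, so `r` now plays the part of the codimension.
  have hHneg : diagonal (fun k => ((-d k : ℝ) : ℂ)) + (t : ℂ) • (-V)
      = U * diagonal (fun i => ((-e i : ℝ) : ℂ)) * Uᴴ := by
    have hdn : ∀ w : ι → ℝ, diagonal (fun k => ((-w k : ℝ) : ℂ)) = -diagonal fun k => (w k : ℂ) := by
      intro w
      ext k l
      by_cases h : k = l
      · subst h; simp
      · simp [h]
    rw [hdn, hdn, mul_neg, neg_mul, ← hH, neg_add, smul_neg]
  obtain ⟨h3, h4⟩ := card_eigenvalues_le_of_double (d := fun k => -d k) (V := -V) (μ := -μ)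
    hV.neg hij (by simp [hi]) (by simp [hj]) hg
    (fun k hk1 hk2 hk => by
      have := hgap k hk1 hk2
      rw [abs_of_nonneg (by linarith)] at this
      linarith) (by simp [hVi]) (by simp [hVj]) (K := K) (by simp [hKdef]) ht htg hU hHneg
  simp only [neg_lt_neg_iff, Matrix.neg_apply, norm_neg, hr] at h3 h4
  set B := ‖V i j‖
  set E := 2 * K ^ 2 / g * t ^ 2
  have s1 : ((univ.val.map e).sort (· ≤ ·)).getD r 0 ≤ μ - t * B + E := sort_getD_le (by omega)
  have s2 : ((univ.val.map e).sort (· ≤ ·)).getD (r + 1) 0 ≤ μ + t * B + E :=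
    sort_getD_le (by omega)
  have s3 : μ + t * B - E ≤ ((univ.val.map e).sort (· ≤ ·)).getD (r + 1) 0 := by
    refine le_sort_getD (by omega) (h3.trans ?_)
    have : #{k | -e k ≤ -μ - t * B + E} = #{k | μ + t * B - E ≤ e k} := by
      congr 1; ext k; simp only [mem_filter, mem_univ, true_and]
      constructor <;> intro h <;> linarith
    omega
  have s4 : μ - t * B - E ≤ ((univ.val.map e).sort (· ≤ ·)).getD r 0 := by
    refine le_sort_getD (by omega) (h4.trans ?_)
    have : #{k | -e k ≤ -μ + t * B + E} = #{k | μ - t * B - E ≤ e k} := by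
      congr 1; ext k; simp only [mem_filter, mem_univ, true_and]
      constructor <;> intro h <;> linarith
    omega
  constructor <;> rw [abs_le] <;> constructor <;> linarith

/-! ### Roots of unity, moduli and phases of `a + τ_n` -/

namespace Nanotube

theorem tau_eq_pow {p : ℕ} (hp : 0 < p) (n : ℕ) :
    tau p n = Complex.exp (2 * Real.pi * Complex.I / (2 * p : ℕ)) ^ n := by
  have : (p : ℂ) ≠ 0 := by exact_mod_cast hp.ne'
  rw [tau, ← Complex.exp_nat_mul]
  congr 1
  push_cast
  field_simp

theorem tau_pow_two_mul {p : ℕ} (hp : 0 < p) (n : ℕ) : tau p n ^ (2 * p) = 1 := by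
  rw [tau_eq_pow hp, ← pow_mul, Nat.mul_comm n, pow_mul,
    (Complex.isPrimitiveRoot_exp (2 * p) (by omega)).pow_eq_one, one_pow]

theorem tau_inj {p : ℕ} (hp : 0 < p) {m n : ℕ} (hm : m < 2 * p) (hn : n < 2 * p)
    (h : tau p m = tau p n) : m = n := by
  rw [tau_eq_pow hp, tau_eq_pow hp] at h
  exact (Complex.isPrimitiveRoot_exp (2 * p) (by omega)).pow_inj hm hn h

theorem tau_eq_exp (p n : ℕ) :
    tau p n = Complex.exp (((Real.pi * n / p : ℝ) : ℂ) * Complex.I) := by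
  rw [tau]
  congr 1
  push_cast
  ring

theorem norm_tau (p n : ℕ) : ‖tau p n‖ = 1 := by
  rw [tau_eq_exp, Complex.norm_exp_ofReal_mul_I]

theorem tau_ne_zero (p n : ℕ) : tau p n ≠ 0 := Complex.exp_ne_zero _

theorem conj_tau_mul_tau (p n : ℕ) : (starRingEnd ℂ) (tau p n) * tau p n = 1 := by
  simp [Complex.conj_mul', norm_tau]

theorem conj_tau_eq_inv (p n : ℕ) : (starRingEnd ℂ) (tau p n) = (tau p n)⁻¹ :=
  eq_inv_of_mul_eq_one_left (conj_tau_mul_tau p n)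

theorem tau_two_mul_sub {p : ℕ} (hp : 0 < p) {n : ℕ} (hn : n ≤ 2 * p) :
    tau p (2 * p - n) = (starRingEnd ℂ) (tau p n) := by
  rw [conj_tau_eq_inv]
  apply eq_inv_of_mul_eq_one_left
  rw [tau_eq_pow hp, tau_eq_pow hp, ← pow_add, Nat.sub_add_cancel hn, ← tau_eq_pow hp, tau]
  have : (p : ℂ) ≠ 0 := by exact_mod_cast hp.ne'
  rw [← Complex.exp_two_pi_mul_I]
  congr 1
  push_cast
  field_simp

theorem tau_self {p : ℕ} (hp : 0 < p) : tau p p = -1 := by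
  have : (p : ℂ) ≠ 0 := by exact_mod_cast hp.ne'
  rw [tau, ← Complex.exp_pi_mul_I]
  congr 1
  field_simp

/-- The modulus of the eigenvalues `± |a + τ_n|` of the unperturbed operator. -/
noncomputable def bandRadius (p : ℕ) (a : ℝ) (n : ℕ) : ℝ := ‖(a : ℂ) + tau p n‖

/-- The phase of `a + τ_n`, with value `1` if `a + τ_n = 0`. -/
noncomputable def bandPhase (p : ℕ) (a : ℝ) (n : ℕ) : ℂ :=
  if (a : ℂ) + tau p n = 0 then 1 else ((a : ℂ) + tau p n) / bandRadius p a n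

/-- The value 1 chosen at `a + τ_n = 0` matters: for `a = 1`, `n = p` the phase stays unimodular, so
the two Bloch functions of eigenvalue 0 are still orthogonal. -/
theorem norm_bandPhase (p : ℕ) (a : ℝ) (n : ℕ) : ‖bandPhase p a n‖ = 1 := by
  unfold bandPhase
  split_ifs with h
  · simp
  · simp [bandRadius, h]

theorem conj_bandPhase_mul (p : ℕ) (a : ℝ) (n : ℕ) :
    (starRingEnd ℂ) (bandPhase p a n) * bandPhase p a n = 1 := by
  simp [Complex.conj_mul', norm_bandPhase]

theorem bandRadius_mul_bandPhase (p : ℕ) (a : ℝ) (n : ℕ) :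
    (bandRadius p a n : ℂ) * bandPhase p a n = a + tau p n := by
  unfold bandPhase
  split_ifs with h
  · simp [bandRadius, h]
  · have : (bandRadius p a n : ℂ) ≠ 0 := by simpa [bandRadius] using h
    field_simp

theorem bandRadius_sq {p : ℕ} (a : ℝ) (n : ℕ) :
    bandRadius p a n ^ 2 = a ^ 2 + 1 + 2 * a * Real.cos (Real.pi * n / p) := by
  rw [bandRadius, tau_eq_exp, Complex.sq_norm, Complex.normSq_apply]
  simp only [Complex.add_re, Complex.ofReal_re, Complex.add_im, Complex.ofReal_im,
    Complex.exp_ofReal_mul_I_re, Complex.exp_ofReal_mul_I_im]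
  nlinarith [Real.sin_sq_add_cos_sq (Real.pi * n / p)]

theorem bandRadius_two_mul_sub {p : ℕ} (hp : 0 < p) (a : ℝ) {n : ℕ} (hn : n ≤ 2 * p) :
    bandRadius p a (2 * p - n) = bandRadius p a n := by
  rw [bandRadius, bandRadius, tau_two_mul_sub hp hn, ← Complex.norm_conj]
  simp

theorem bandPhase_two_mul_sub {p : ℕ} (hp : 0 < p) (a : ℝ) {n : ℕ} (hn : n ≤ 2 * p) :
    bandPhase p a (2 * p - n) = (starRingEnd ℂ) (bandPhase p a n) := by
  have h : (a : ℂ) + tau p (2 * p - n) = (starRingEnd ℂ) ((a : ℂ) + tau p n) := by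
    simp [tau_two_mul_sub hp hn]
  unfold bandPhase
  rw [h, bandRadius_two_mul_sub hp a hn]
  by_cases h0 : (a : ℂ) + tau p n = 0
  · simp [h0]
  · rw [if_neg h0, if_neg (by simpa only [map_eq_zero] using h0), map_div₀, Complex.conj_ofReal]

theorem bandRadius_min {p : ℕ} (hp : 0 < p) (a : ℝ) {n : ℕ} (hn : n ≤ 2 * p) :
    bandRadius p a (min n (2 * p - n)) = bandRadius p a n := by
  rcases min_cases n (2 * p - n) with ⟨h, _⟩ | ⟨h, _⟩ <;> rw [h]
  exact bandRadius_two_mul_sub hp a hn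

theorem bandRadius_lt_of_lt {p : ℕ} (hp : 0 < p) {a : ℝ} (ha : 0 < a) {m n : ℕ} (hmn : m < n)
    (hn : n ≤ p) : bandRadius p a n < bandRadius p a m := by
  have hp' : (0 : ℝ) < p := by exact_mod_cast hp
  have hcos : Real.cos (Real.pi * n / p) < Real.cos (Real.pi * m / p) := by
    apply Real.cos_lt_cos_of_nonneg_of_le_pi
    · positivity
    · rw [div_le_iff₀ hp']
      have : (n : ℝ) ≤ p := by exact_mod_cast hn
      gcongr
    · have : (m : ℝ) < n := by exact_mod_cast hmn
      gcongr
  apply lt_of_pow_lt_pow_left₀ 2 (b := bandRadius p a m) (norm_nonneg _)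
  rw [bandRadius_sq, bandRadius_sq]
  gcongr

/-- The squared radius is `a² + 1 + 2a cos(πn/p)` with `a > 0`, hence strictly decreasing on `[0,
p]` and symmetric under `n ↦ 2p - n`. Folding by `min` turns comparison of radii into arithmetic. -/
theorem bandRadius_lt_iff {p : ℕ} (hp : 0 < p) {a : ℝ} (ha : 0 < a) {m n : ℕ} (hm : m ≤ 2 * p)
    (hn : n ≤ 2 * p) :
    bandRadius p a m < bandRadius p a n ↔ min n (2 * p - n) < min m (2 * p - m) := by
  rw [← bandRadius_min hp a hm, ← bandRadius_min hp a hn]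
  constructor
  · intro h
    by_contra! h'
    rcases h'.lt_or_eq with h' | h'
    · exact lt_asymm h (bandRadius_lt_of_lt hp ha h' (by omega))
    · exact h.ne (by rw [h'])
  · intro h
    exact bandRadius_lt_of_lt hp ha h (by omega)

theorem bandRadius_eq_iff {p : ℕ} (hp : 0 < p) {a : ℝ} (ha : 0 < a) {m n : ℕ} (hm : m ≤ 2 * p)
    (hn : n ≤ 2 * p) :
    bandRadius p a m = bandRadius p a n ↔ m = n ∨ m = 2 * p - n := by
  have h1 := bandRadius_lt_iff hp ha hm hn
  have h2 := bandRadius_lt_iff hp ha hn hm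
  rw [eq_iff_le_not_lt, ← not_lt, h1, h2]
  omega

theorem bandRadius_pos {p : ℕ} (hp : 0 < p) {a : ℝ} (ha : 0 < a) {n : ℕ} (hn : n ≤ 2 * p)
    (hnp : n ≠ p) : 0 < bandRadius p a n :=
  (norm_nonneg ((a : ℂ) + tau p p)).trans_lt
    ((bandRadius_lt_iff hp ha (by omega) hn).2 (by omega))

theorem bandRadius_self_one {p : ℕ} (hp : 0 < p) : bandRadius p 1 p = 0 := by
  simp [bandRadius, tau_self hp]

/-! ### Bloch diagonalization of the unperturbed operator -/

/-- The sign attached to a Boolean. -/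
def boolSign (s : Bool) : ℝ := if s then 1 else -1

theorem boolSign_mul_self (s : Bool) : boolSign s * boolSign s = 1 := by
  cases s <;> simp [boolSign]

theorem boolSign_mul_of_ne {s s' : Bool} (h : s ≠ s') : boolSign s * boolSign s' = -1 := by
  cases s <;> cases s' <;> simp_all [boolSign]

/-- The eigenvalues of the unperturbed operator. -/
noncomputable def freeEigenvalue (p : ℕ) (a : ℝ) (k : Fin (2 * p) × Bool) : ℝ :=
  boolSign k.2 * bandRadius p a k.1

/-- The Bloch eigenfunctions of the unperturbed operator. -/
noncomputable def bloch (p : ℕ) (a : ℝ) (k : Fin (2 * p) × Bool) (x : ℤ) : ℂ :=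
  tau p k.1 ^ (x / 2) * if Even x then 1 else boolSign k.2 * bandPhase p a k.1

theorem bloch_two_mul (p : ℕ) (a : ℝ) (k : Fin (2 * p) × Bool) (q : ℤ) :
    bloch p a k (2 * q) = tau p k.1 ^ q := by
  simp [bloch]

theorem bloch_two_mul_add_one (p : ℕ) (a : ℝ) (k : Fin (2 * p) × Bool) (q : ℤ) :
    bloch p a k (2 * q + 1) = tau p k.1 ^ q * (boolSign k.2 * bandPhase p a k.1) := by
  have h1 : (2 * q + 1) / 2 = q := by omega
  simp [bloch, h1]

theorem bloch_add_period {p : ℕ} (hp : 0 < p) (a : ℝ) (k : Fin (2 * p) × Bool) (x : ℤ) :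
    bloch p a k (x + ((4 * p : ℕ) : ℤ)) = bloch p a k x := by
  have h1 : (x + ((4 * p : ℕ) : ℤ)) / 2 = x / 2 + ((2 * p : ℕ) : ℤ) := by push_cast; omega
  have h2 : Even (x + ((4 * p : ℕ) : ℤ)) ↔ Even x := by
    simp only [Int.even_iff]; push_cast; omega
  unfold bloch
  rw [h1, zpow_add₀ (tau_ne_zero _ _), zpow_natCast, tau_pow_two_mul hp, mul_one]
  simp only [h2]

theorem bloch_eigen (p : ℕ) (a : ℝ) (k : Fin (2 * p) × Bool) (x : ℤ) :
    (weight a (x - 1) : ℂ) * bloch p a k (x - 1) + (weight a x : ℂ) * bloch p a k (x + 1)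
      = freeEigenvalue p a k * bloch p a k x := by
  have hs : (boolSign k.2 : ℂ) * boolSign k.2 = 1 := by exact_mod_cast boolSign_mul_self k.2
  have hu := conj_bandPhase_mul p a k.1
  have hr := bandRadius_mul_bandPhase p a k.1
  have ht := tau_ne_zero p k.1
  rcases Int.even_or_odd' x with ⟨q, rfl | rfl⟩
  · have h1 : ¬ Even (2 * q - 1) := by simp
    have h2 : (2 * q - 1 : ℤ) = 2 * (q - 1) + 1 := by ring
    rw [weight, weight, if_neg h1, if_pos (even_two_mul q), h2, bloch_two_mul_add_one,
      bloch_two_mul_add_one, bloch_two_mul, zpow_sub_one₀ ht, freeEigenvalue]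
    have hr' : (bandRadius p a k.1 : ℂ) * (starRingEnd ℂ) (bandPhase p a k.1)
        = a + (tau p k.1)⁻¹ := by
      have := congrArg (starRingEnd ℂ) hr
      simpa [conj_tau_eq_inv] using this
    push_cast
    linear_combination (-(tau p k.1 ^ q * boolSign k.2 * bandPhase p a k.1)) * hr'
      + tau p k.1 ^ q * boolSign k.2 * bandRadius p a k.1 * hu
  · have h1 : ¬ Even (2 * q + 1) := by simp
    have h2 : (2 * q + 1 + 1 : ℤ) = 2 * (q + 1) := by ring
    rw [weight, weight, if_neg h1, add_sub_cancel_right, if_pos (even_two_mul q), h2,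
      bloch_two_mul, bloch_two_mul, bloch_two_mul_add_one, zpow_add_one₀ ht, freeEigenvalue]
    push_cast
    linear_combination (-(tau p k.1 ^ q)) * hr
      - tau p k.1 ^ q * bandRadius p a k.1 * bandPhase p a k.1 * hs

theorem sum_periodicMatrix_mul {p : ℕ} (hp : 0 < p) (a : ℝ) (v : ℤ → ℝ) {y : ℤ → ℂ}
    (hy : ∀ x, y (x + ((4 * p : ℕ) : ℤ)) = y x) (i : Fin (4 * p)) :
    ∑ j : Fin (4 * p), (periodicMatrix p a v i j : ℂ) * y ((j : ℕ) : ℤ)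
      = (weight a (((i : ℕ) : ℤ) - 1) : ℂ) * y (((i : ℕ) : ℤ) - 1)
        + (weight a ((i : ℕ) : ℤ) : ℂ) * y (((i : ℕ) : ℤ) + 1)
        + (v ((i : ℕ) : ℤ) : ℂ) * y ((i : ℕ) : ℤ) := by
  have hmod : ∀ x : ℤ, y (x % ((4 * p : ℕ) : ℤ)) = y x := by
    have hper : Function.Periodic y ((4 * p : ℕ) : ℤ) := hy
    intro x
    conv_rhs => rw [← Int.emod_add_mul_ediv x ((4 * p : ℕ) : ℤ)]
    rw [mul_comm ((4 * p : ℕ) : ℤ)]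
    exact (hper.int_mul _ _).symm
  -- The columns are the operator applied to periodized unit vectors; summing these against a
  -- periodic `y` restores `y`, wrap-around included.
  have hpick : ∀ x : ℤ, ∑ j : Fin (4 * p),
      (if x % ((4 * p : ℕ) : ℤ) = ((j : ℕ) : ℤ) then (1 : ℂ) else 0) * y ((j : ℕ) : ℤ) = y x := by
    intro x
    have h0 : 0 ≤ x % ((4 * p : ℕ) : ℤ) := Int.emod_nonneg _ (by omega)
    have h1 : x % ((4 * p : ℕ) : ℤ) < ((4 * p : ℕ) : ℤ) := Int.emod_lt_of_pos _ (by omega)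
    rw [Finset.sum_eq_single ⟨(x % ((4 * p : ℕ) : ℤ)).toNat, by omega⟩]
    · simp only [Int.toNat_of_nonneg h0, if_true, one_mul, hmod]
    · intro j _ hj
      rw [if_neg, zero_mul]
      intro h
      apply hj
      ext
      simp only
      omega
    · simp
  rw [← hpick (((i : ℕ) : ℤ) - 1), ← hpick (((i : ℕ) : ℤ) + 1), Finset.mul_sum, Finset.mul_sum,
    ← Finset.sum_add_distrib]
  conv_rhs => rw [← hpick ((i : ℕ) : ℤ), Finset.mul_sum, ← Finset.sum_add_distrib]
  refine Finset.sum_congr rfl fun j _ => ?_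
  simp only [periodicMatrix, jacobi, Matrix.of_apply]
  simp only [Complex.ofReal_add, Complex.ofReal_mul, apply_ite Complex.ofReal, Complex.ofReal_one,
    Complex.ofReal_zero]
  ring

theorem sum_fin_four_mul (p : ℕ) (F : ℤ → ℂ) :
    ∑ x : Fin (4 * p), F ((x : ℕ) : ℤ)
      = ∑ q ∈ Finset.range (2 * p), (F (2 * (q : ℤ)) + F (2 * (q : ℤ) + 1)) := by
  have h : ∀ k : ℕ, ∑ x ∈ Finset.range (2 * k), F (x : ℤ)
      = ∑ q ∈ Finset.range k, (F (2 * (q : ℤ)) + F (2 * (q : ℤ) + 1)) := by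
    intro k
    induction k with
    | zero => simp
    | succ k ih =>
      rw [Finset.sum_range_succ, ← ih, mul_add, mul_one, Finset.sum_range_succ,
        Finset.sum_range_succ]
      push_cast
      ring
  rw [Fin.sum_univ_eq_sum_range (fun x : ℕ => F x), ← h]
  congr 2
  ring

theorem sum_mul_conj_bloch_mul_bloch (p : ℕ) (a : ℝ) (w : ℤ → ℂ) (k k' : Fin (2 * p) × Bool) :
    ∑ x : Fin (4 * p), w ((x : ℕ) : ℤ) * ((starRingEnd ℂ) (bloch p a k ((x : ℕ) : ℤ))
        * bloch p a k' ((x : ℕ) : ℤ))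
      = ∑ q ∈ Finset.range (2 * p), ((starRingEnd ℂ) (tau p k.1) * tau p k'.1) ^ q
        * (w (2 * (q : ℤ)) + w (2 * (q : ℤ) + 1) * ((boolSign k.2 * boolSign k'.2 : ℝ)
          * ((starRingEnd ℂ) (bandPhase p a k.1) * bandPhase p a k'.1))) := by
  rw [sum_fin_four_mul p fun x => w x * ((starRingEnd ℂ) (bloch p a k x) * bloch p a k' x)]
  refine Finset.sum_congr rfl fun q _ => ?_
  simp only [bloch_two_mul, bloch_two_mul_add_one, zpow_natCast, map_mul, map_pow,
    Complex.conj_ofReal, mul_pow]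
  push_cast
  ring

/-- Different multipliers give a vanishing geometric sum over a full period; equal multipliers with
opposite signs cancel between even and odd sites. -/
theorem sum_conj_bloch_mul_bloch {p : ℕ} (hp : 0 < p) (a : ℝ) (k k' : Fin (2 * p) × Bool) :
    ∑ x : Fin (4 * p), (starRingEnd ℂ) (bloch p a k ((x : ℕ) : ℤ)) * bloch p a k' ((x : ℕ) : ℤ)
      = if k = k' then 4 * (p : ℂ) else 0 := by
  have h := sum_mul_conj_bloch_mul_bloch p a (fun _ => 1) k k'
  simp only [one_mul] at h
  rw [h, ← Finset.sum_mul]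
  by_cases h1 : k.1 = k'.1
  · rw [h1, conj_tau_mul_tau, conj_bandPhase_mul]
    by_cases h2 : k.2 = k'.2
    · rw [if_pos (Prod.ext h1 h2), h2, boolSign_mul_self]
      simp
      ring
    · rw [if_neg (fun h => h2 (by rw [h])), boolSign_mul_of_ne h2]
      simp
  · rw [if_neg (fun h => h1 (by rw [h]))]
    have hne : (starRingEnd ℂ) (tau p k.1) * tau p k'.1 ≠ 1 := by
      intro h
      rw [conj_tau_eq_inv, inv_mul_eq_one₀ (tau_ne_zero _ _)] at h
      exact h1 (Fin.ext (tau_inj hp k.1.2 k'.1.2 h))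
    have hone : ((starRingEnd ℂ) (tau p k.1) * tau p k'.1) ^ (2 * p) = 1 := by
      rw [mul_pow, ← map_pow, tau_pow_two_mul hp, tau_pow_two_mul hp]
      simp
    have : ∑ q ∈ Finset.range (2 * p), ((starRingEnd ℂ) (tau p k.1) * tau p k'.1) ^ q = 0 := by
      rw [geom_sum_eq hne, hone]
      simp
    rw [this, zero_mul]

/-- The matrix whose columns are the normalized Bloch eigenfunctions. -/
noncomputable def blochMatrix (p : ℕ) (a : ℝ) :
    Matrix (Fin (4 * p)) (Fin (2 * p) × Bool) ℂ :=
  Matrix.of fun x k => ((√(4 * p : ℝ))⁻¹ : ℝ) * bloch p a k ((x : ℕ) : ℤ)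

/-- The potential in the Bloch basis. -/
noncomputable def blochPotential (p : ℕ) (a : ℝ) (v : ℤ → ℝ) :
    Matrix (Fin (2 * p) × Bool) (Fin (2 * p) × Bool) ℂ :=
  (blochMatrix p a).conjTranspose * Matrix.diagonal (fun x : Fin (4 * p) => (v ((x : ℕ) : ℤ) : ℂ))
    * blochMatrix p a

theorem blochPotential_apply {p : ℕ} (a : ℝ) (v : ℤ → ℝ) (k k' : Fin (2 * p) × Bool) :
    blochPotential p a v k k' = (4 * (p : ℂ))⁻¹ *
      ∑ q ∈ Finset.range (2 * p), ((starRingEnd ℂ) (tau p k.1) * tau p k'.1) ^ q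
        * (v (2 * (q : ℤ)) + v (2 * (q : ℤ) + 1) * ((boolSign k.2 * boolSign k'.2 : ℝ)
          * ((starRingEnd ℂ) (bandPhase p a k.1) * bandPhase p a k'.1))) := by
  rw [← sum_mul_conj_bloch_mul_bloch p a (fun x => (v x : ℂ)), blochPotential, Matrix.mul_apply,
    Finset.mul_sum]
  refine Finset.sum_congr rfl fun x _ => ?_
  have : ((√(4 * p : ℝ))⁻¹ : ℂ) * ((√(4 * p : ℝ))⁻¹ : ℂ) = (4 * (p : ℂ))⁻¹ := by
    rw [← mul_inv, ← Complex.ofReal_mul, Real.mul_self_sqrt (by positivity)]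
    push_cast
    rfl
  rw [← this]
  simp only [Matrix.mul_diagonal, Matrix.conjTranspose_apply, blochMatrix, Matrix.of_apply,
    RCLike.star_def, map_mul, Complex.conj_ofReal]
  push_cast
  ring

theorem blochPotential_isHermitian (p : ℕ) (a : ℝ) (v : ℤ → ℝ) :
    (blochPotential p a v).IsHermitian := by
  refine Matrix.isHermitian_conjTranspose_mul_mul _ (Matrix.isHermitian_diagonal_iff.2 fun x => ?_)
  simp [IsSelfAdjoint]

theorem conjTranspose_blochMatrix_mul_self {p : ℕ} (hp : 0 < p) (a : ℝ) :
    (blochMatrix p a).conjTranspose * blochMatrix p a = 1 := by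
  ext k k'
  have h := sum_conj_bloch_mul_bloch hp a k k'
  have hp' : (p : ℂ) ≠ 0 := by exact_mod_cast hp.ne'
  have hsq : ((√(4 * p : ℝ))⁻¹ : ℂ) * ((√(4 * p : ℝ))⁻¹ : ℂ) = (4 * (p : ℂ))⁻¹ := by
    rw [← mul_inv, ← Complex.ofReal_mul, Real.mul_self_sqrt (by positivity)]
    push_cast
    rfl
  have : ((blochMatrix p a).conjTranspose * blochMatrix p a) k k'
      = (4 * (p : ℂ))⁻¹ * if k = k' then 4 * (p : ℂ) else 0 := by
    rw [← h, Matrix.mul_apply, Finset.mul_sum, ← hsq]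
    refine Finset.sum_congr rfl fun x _ => ?_
    simp only [Matrix.conjTranspose_apply, blochMatrix, Matrix.of_apply,
      RCLike.star_def, map_mul, Complex.conj_ofReal]
    push_cast
    ring
  rw [this, Matrix.one_apply]
  split_ifs
  · field_simp
  · simp

theorem card_index (p : ℕ) : Fintype.card (Fin (2 * p) × Bool) = 4 * p := by
  simp; ring

theorem blochMatrix_mul_conjTranspose {p : ℕ} (hp : 0 < p) (a : ℝ) :
    blochMatrix p a * (blochMatrix p a).conjTranspose = 1 :=
  (Matrix.mul_eq_one_comm_of_card_eq _ _ _ (by rw [card_index, Fintype.card_fin])).1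
    (conjTranspose_blochMatrix_mul_self hp a)

theorem periodicMatrix_mul_blochMatrix {p : ℕ} (hp : 0 < p) (a : ℝ) (v : ℤ → ℝ) :
    (periodicMatrix p a v).map Complex.ofReal * blochMatrix p a
      = blochMatrix p a * Matrix.diagonal (fun k => (freeEigenvalue p a k : ℂ))
        + Matrix.diagonal (fun x : Fin (4 * p) => (v ((x : ℕ) : ℤ) : ℂ)) * blochMatrix p a := by
  ext x k
  have h := sum_periodicMatrix_mul hp a v (bloch_add_period hp a k) x
  rw [bloch_eigen] at h
  rw [Matrix.add_apply, Matrix.mul_diagonal, Matrix.diagonal_mul, Matrix.mul_apply]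
  simp only [blochMatrix, Matrix.of_apply, Matrix.map_apply]
  simp only [mul_left_comm _ (((√(4 * p : ℝ))⁻¹ : ℝ) : ℂ)]
  rw [← Finset.mul_sum, h]
  ring

/-- The Bloch matrix is unitary between different index types, so the similarity is expressed by
commuting the factors of a rectangular product inside the characteristic polynomial. -/
theorem charpoly_periodicMatrix_map {p : ℕ} (hp : 0 < p) (a : ℝ) (v : ℤ → ℝ) (t : ℝ) :
    ((periodicMatrix p a (t • v)).map Complex.ofReal).charpoly
      = (Matrix.diagonal (fun k => (freeEigenvalue p a k : ℂ))
          + (t : ℂ) • blochPotential p a v).charpoly := by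
  set A := (periodicMatrix p a (t • v)).map Complex.ofReal
  set B := blochMatrix p a with hB
  have h1 : B.conjTranspose * B = 1 := conjTranspose_blochMatrix_mul_self hp a
  have h2 : B * B.conjTranspose = 1 := blochMatrix_mul_conjTranspose hp a
  have h3 : Matrix.diagonal (fun k => (freeEigenvalue p a k : ℂ))
      + (t : ℂ) • blochPotential p a v = B.conjTranspose * (A * B) := by
    have hd : Matrix.diagonal (fun x : Fin (4 * p) => (((t • v) ((x : ℕ) : ℤ) : ℝ) : ℂ))
        = (t : ℂ) • Matrix.diagonal (fun x : Fin (4 * p) => (v ((x : ℕ) : ℤ) : ℂ)) := by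
      rw [← Matrix.diagonal_smul]
      congr 1
      ext x
      simp
    rw [periodicMatrix_mul_blochMatrix hp, Matrix.mul_add, ← Matrix.mul_assoc, h1, Matrix.one_mul, hd,
      Matrix.smul_mul, Matrix.mul_smul, blochPotential, Matrix.mul_assoc]
  have h4 : Fintype.card (Fin (4 * p)) = Fintype.card (Fin (2 * p) × Bool) := by
    rw [card_index, Fintype.card_fin]
  rw [h3, Matrix.charpoly_mul_comm_of_le _ _ h4.le, h4, Nat.sub_self, pow_zero, one_mul,
    Matrix.mul_assoc, h2, Matrix.mul_one]

-- This puts the band edges in the form required by the splitting theorem. `U` and `e` depend on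
-- `t`, which is why that theorem fixes its constants before quantifying over them.
open Matrix Polynomial in
theorem periodicEigenvalue_eq {p : ℕ} (hp : 0 < p) (a : ℝ) (v : ℤ → ℝ) (t : ℝ) :
    ∃ (U : Matrix (Fin (2 * p) × Bool) (Fin (2 * p) × Bool) ℂ) (e : Fin (2 * p) × Bool → ℝ),
      U * Uᴴ = 1 ∧ diagonal (fun k => (freeEigenvalue p a k : ℂ)) + (t : ℂ) • blochPotential p a v
        = U * diagonal (fun k => (e k : ℂ)) * Uᴴ ∧
      ∀ r, periodicEigenvalue p a (t • v) r
        = ((Finset.univ.val.map e).sort (· ≤ ·)).getD r 0 := by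
  set H := diagonal (fun k => (freeEigenvalue p a k : ℂ)) + (t : ℂ) • blochPotential p a v with hHd
  have hH : H.IsHermitian := by
    refine (Matrix.isHermitian_diagonal_iff.2 fun x => by simp [IsSelfAdjoint]).add
      ((blochPotential_isHermitian p a v).smul ?_)
    simp [IsSelfAdjoint]
  refine ⟨hH.eigenvectorUnitary, hH.eigenvalues, ?_, ?_, fun r => ?_⟩
  · rw [← star_eq_conjTranspose]
    exact Unitary.coe_mul_star_self _
  · have := hH.spectral_theorem
    rw [Unitary.conjStarAlgAut_apply] at this
    exact this
  · have h1 : (periodicMatrix p a (t • v)).charpoly = ∏ k, (X - C (hH.eigenvalues k)) := by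
      apply Polynomial.map_injective Complex.ofRealHom Complex.ofReal_injective
      rw [← Matrix.charpoly_map]
      have := charpoly_periodicMatrix_map hp a v t
      rw [← hHd, hH.charpoly_eq] at this
      refine (Eq.trans ?_ this).trans ?_
      · rfl
      · rw [Polynomial.map_prod]
        simp
    have h2 : (∏ k, (X - C (hH.eigenvalues k))).roots = Finset.univ.val.map hH.eigenvalues := by
      rw [Polynomial.roots_prod]
      · simp
      · simp [Finset.prod_ne_zero_iff, Polynomial.X_sub_C_ne_zero]
    rw [periodicEigenvalue, h1, h2]

end Nanotube

/-! ### Position of the double eigenvalues and matrix elements of the potential -/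

namespace Nanotube

open Finset in
theorem card_filter_min_lt {p k : ℕ} (hk : 1 ≤ k) (hkp : k ≤ p) :
    #{m : Fin (2 * p) | min (m : ℕ) (2 * p - m) < k} = 2 * k - 1 := by
  have h : #{m : Fin (2 * p) | min (m : ℕ) (2 * p - m) < k}
      = #((range (2 * p)).filter fun m => min m (2 * p - m) < k) := by
    rw [card_filter, card_filter,
      Fin.sum_univ_eq_sum_range (fun m : ℕ => if min m (2 * p - m) < k then 1 else 0)]
  have h2 : ((range (2 * p)).filter fun m => min m (2 * p - m) < k)
      = range k ∪ Ioo (2 * p - k) (2 * p) := by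
    ext m
    simp only [mem_filter, mem_range, mem_union, mem_Ioo]
    omega
  rw [h, h2, card_union_of_disjoint, card_range, Nat.card_Ioo]
  · omega
  · rw [disjoint_left]
    intro m hm
    simp only [mem_range, mem_Ioo] at hm ⊢
    omega

theorem freeEigenvalue_true (p : ℕ) (a : ℝ) (m : Fin (2 * p)) :
    freeEigenvalue p a (m, true) = bandRadius p a m := by
  simp [freeEigenvalue, boolSign]

theorem freeEigenvalue_false (p : ℕ) (a : ℝ) (m : Fin (2 * p)) :
    freeEigenvalue p a (m, false) = -bandRadius p a m := by
  simp [freeEigenvalue, boolSign]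

theorem bandRadius_nonneg (p : ℕ) (a : ℝ) (n : ℕ) : 0 ≤ bandRadius p a n := norm_nonneg _

open Finset in
theorem card_freeEigenvalue_lt_neg {p : ℕ} (hp : 0 < p) {a : ℝ} (ha : 0 < a) {n : ℕ}
    (hn : 1 ≤ n) (hnp : n ≤ p) :
    #{k | freeEigenvalue p a k < -bandRadius p a n} = 2 * n - 1 := by
  rw [← card_filter_min_lt hn hnp]
  have : (univ.filter fun k : Fin (2 * p) × Bool => freeEigenvalue p a k < -bandRadius p a n)
      = (univ.filter fun m : Fin (2 * p) => min (m : ℕ) (2 * p - m) < n) ×ˢ {false} := by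
    ext ⟨m, s⟩
    simp only [mem_filter, mem_univ, true_and, mem_product, mem_singleton]
    cases s
    · rw [freeEigenvalue_false, neg_lt_neg_iff, bandRadius_lt_iff hp ha (by omega) (by omega)]
      simp only [and_true]
      omega
    · rw [freeEigenvalue_true]
      have h1 := bandRadius_nonneg p a m
      have h2 := bandRadius_nonneg p a n
      simp only [Bool.true_eq_false, and_false, iff_false, not_lt]
      linarith
  rw [this, card_product, card_singleton, mul_one]

-- Counting the complement is easier: the eigenvalues not below this one are all positive and
-- correspond to folded indices at most `2p - n`, so there are `4p - 2n + 1` of them out of `4p`.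
open Finset in
theorem card_freeEigenvalue_lt_pos {p : ℕ} (hp : 0 < p) {a : ℝ} (ha : 0 < a) {n : ℕ}
    (hn : p < n) (hnp : n < 2 * p) :
    #{k | freeEigenvalue p a k < bandRadius p a n} = 2 * n - 1 := by
  have hn0 : 0 < bandRadius p a n := bandRadius_pos hp ha hnp.le hn.ne'
  have hc := card_filter_min_lt (p := p) (k := 2 * p - n + 1) (by omega) (by omega)
  have : (univ.filter fun k : Fin (2 * p) × Bool => ¬ freeEigenvalue p a k < bandRadius p a n)
      = (univ.filter fun m : Fin (2 * p) => min (m : ℕ) (2 * p - m) < 2 * p - n + 1)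
        ×ˢ {true} := by
    ext ⟨m, s⟩
    simp only [mem_filter, mem_univ, true_and, mem_product, mem_singleton]
    cases s
    · rw [freeEigenvalue_false]
      have h1 := bandRadius_nonneg p a m
      simp only [Bool.false_eq_true, and_false, iff_false, not_not]
      linarith
    · rw [freeEigenvalue_true, bandRadius_lt_iff hp ha (by omega) (by omega)]
      simp only [and_true]
      omega
  have h := card_filter_add_card_filter_not (s := (univ : Finset (Fin (2 * p) × Bool)))
    (fun k => freeEigenvalue p a k < bandRadius p a n)
  rw [this, card_product, card_singleton, mul_one, hc, card_univ, card_index] at h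
  omega

theorem sum_range_two_mul_of_periodic {p : ℕ} {g : ℕ → ℂ} (hg : ∀ q, g (q + p) = g q) :
    ∑ q ∈ Finset.range (2 * p), g q = 2 * ∑ q ∈ Finset.Icc 1 p, g q := by
  have h1 : ∑ q ∈ Finset.Icc 1 p, g q = ∑ q ∈ Finset.range p, g q := by
    have h2 := Finset.sum_range_succ' g p
    rw [Finset.sum_range_succ] at h2
    have h3 := hg 0
    rw [zero_add] at h3
    rw [h3] at h2
    rw [add_right_cancel h2]
    have h4 : ∀ k, ∑ q ∈ Finset.Icc 1 k, g q = ∑ q ∈ Finset.range k, g (q + 1) := by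
      intro k
      induction k with
      | zero => simp
      | succ k ih => rw [Finset.sum_Icc_succ_top (by omega), ih, Finset.sum_range_succ]
    exact h4 p
  rw [two_mul p, Finset.sum_range_add, h1, two_mul]
  congr 1
  exact Finset.sum_congr rfl fun q _ => by rw [add_comm, hg]

theorem sum_even_mul_conj_tau {p : ℕ} (hp : 0 < p) {v : ℤ → ℝ}
    (hv : ∀ x, v (x + ((2 * p : ℕ) : ℤ)) = v x) (n : ℕ) :
    ∑ q ∈ Finset.range (2 * p), (v (2 * (q : ℤ)) : ℂ) * (starRingEnd ℂ) (tau p n) ^ (2 * q)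
      = 4 * p * hat p v 0 n := by
  have hp' : (p : ℂ) ≠ 0 := by exact_mod_cast hp.ne'
  rw [sum_range_two_mul_of_periodic
    (g := fun q => (v (2 * (q : ℤ)) : ℂ) * (starRingEnd ℂ) (tau p n) ^ (2 * q)), hat,
    Finset.mul_sum, Finset.mul_sum]
  · refine Finset.sum_congr rfl fun m _ => ?_
    simp only [fourierVec, map_mul, map_pow, map_div₀, map_one, map_natCast, map_ofNat]
    simp only [Fin.val_zero, Nat.cast_zero, sub_zero]
    field_simp
    ring
  · intro q
    have h1 : (2 * ((q + p : ℕ) : ℤ)) = 2 * (q : ℤ) + ((2 * p : ℕ) : ℤ) := by push_cast; ring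
    rw [h1, hv, mul_add 2 q p, pow_add, ← map_pow _ _ (2 * p), tau_pow_two_mul hp, map_one,
      mul_one]

/-- The factor `τ_n²` comes from the indexing: site `2q + 1` is the entry `m = q + 1` of `v^1`,
whose entries are `v_{2m-1}`. -/
theorem sum_odd_mul_conj_tau {p : ℕ} (hp : 0 < p) {v : ℤ → ℝ}
    (hv : ∀ x, v (x + ((2 * p : ℕ) : ℤ)) = v x) (n : ℕ) :
    ∑ q ∈ Finset.range (2 * p), (v (2 * (q : ℤ) + 1) : ℂ) * (starRingEnd ℂ) (tau p n) ^ (2 * q)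
      = 4 * p * (tau p n ^ 2 * hat p v 1 n) := by
  have hp' : (p : ℂ) ≠ 0 := by exact_mod_cast hp.ne'
  have hper : ∀ q : ℕ, (v (2 * ((q + p : ℕ) : ℤ) - 1) : ℂ)
        * (starRingEnd ℂ) (tau p n) ^ (2 * (q + p))
      = (v (2 * (q : ℤ) - 1) : ℂ) * (starRingEnd ℂ) (tau p n) ^ (2 * q) := by
    intro q
    have h1 : (2 * ((q + p : ℕ) : ℤ) - 1) = (2 * (q : ℤ) - 1) + ((2 * p : ℕ) : ℤ) := by
      push_cast; ring
    rw [h1, hv, mul_add 2 q p, pow_add, ← map_pow _ _ (2 * p), tau_pow_two_mul hp, map_one,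
      mul_one]
  have hshift : ∀ q : ℕ, (v (2 * (q : ℤ) + 1) : ℂ) * (starRingEnd ℂ) (tau p n) ^ (2 * q)
      = tau p n ^ 2 * ((v (2 * ((q + 1 : ℕ) : ℤ) - 1) : ℂ)
        * (starRingEnd ℂ) (tau p n) ^ (2 * (q + 1))) := by
    intro q
    have h1 : (2 * ((q + 1 : ℕ) : ℤ) - 1) = 2 * (q : ℤ) + 1 := by push_cast; ring
    have h2 := conj_tau_mul_tau p n
    have h3 : tau p n ^ 2 * (starRingEnd ℂ) (tau p n) ^ 2 = 1 := by
      rw [← mul_pow, mul_comm, h2, one_pow]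
    rw [h1, mul_add 2 q 1, pow_add]
    linear_combination (-((v (2 * (q : ℤ) + 1) : ℂ) * (starRingEnd ℂ) (tau p n) ^ (2 * q))) * h3
  rw [Finset.sum_congr rfl fun q _ => hshift q, ← Finset.mul_sum,
    sum_range_two_mul_of_periodic (g := fun q => (v (2 * ((q + 1 : ℕ) : ℤ) - 1) : ℂ)
        * (starRingEnd ℂ) (tau p n) ^ (2 * (q + 1)))
      (fun q => by rw [add_right_comm]; exact hper (q + 1)),
    ← sum_range_two_mul_of_periodic (g := fun q => (v (2 * ((q + 1 : ℕ) : ℤ) - 1) : ℂ)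
        * (starRingEnd ℂ) (tau p n) ^ (2 * (q + 1)))
      (fun q => by rw [add_right_comm]; exact hper (q + 1))]
  have h4 : ∑ q ∈ Finset.range (2 * p), (v (2 * ((q + 1 : ℕ) : ℤ) - 1) : ℂ)
        * (starRingEnd ℂ) (tau p n) ^ (2 * (q + 1))
      = ∑ q ∈ Finset.range (2 * p), (v (2 * (q : ℤ) - 1) : ℂ)
        * (starRingEnd ℂ) (tau p n) ^ (2 * q) := by
    have e := Finset.sum_range_succ' (fun q : ℕ => (v (2 * (q : ℤ) - 1) : ℂ)
        * (starRingEnd ℂ) (tau p n) ^ (2 * q)) (2 * p)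
    have e2 := hper 0
    rw [zero_add] at e2
    rw [Finset.sum_range_succ, two_mul p, hper p, e2] at e
    rw [two_mul p]
    exact (add_right_cancel e).symm
  rw [h4, sum_range_two_mul_of_periodic (g := fun q => (v (2 * (q : ℤ) - 1) : ℂ)
        * (starRingEnd ℂ) (tau p n) ^ (2 * q)) hper, hat, ← mul_assoc (4 * (p : ℂ)),
    mul_comm (4 * (p : ℂ)), mul_assoc]
  congr 1
  rw [Finset.mul_sum, Finset.mul_sum]
  refine Finset.sum_congr rfl fun m _ => ?_
  simp only [fourierVec, map_mul, map_pow, map_div₀, map_one, map_natCast, map_ofNat]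
  simp only [Fin.val_one, Nat.cast_one]
  field_simp
  ring

/-- The matrix element of the potential between the two Bloch functions with eigenvalue of
modulus `|a + τ_n|`. -/
noncomputable def coupling (p : ℕ) (a : ℝ) (v : ℤ → ℝ) (n : ℕ) : ℝ :=
  if n = p then ‖hat p v 0 n - hat p v 1 n‖
  else ‖hat p v 0 n + ((starRingEnd ℂ) (bandPhase p a n) * tau p n) ^ 2 * hat p v 1 n‖

theorem blochPotential_apply_self {p : ℕ} (a : ℝ) {v : ℤ → ℝ}
    (h0 : ∑ x ∈ Finset.range (2 * p), (v (2 * (x : ℤ)) + v (2 * (x : ℤ) + 1)) = 0)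
    (k : Fin (2 * p) × Bool) : blochPotential p a v k k = 0 := by
  rw [blochPotential_apply]
  simp only [conj_tau_mul_tau, conj_bandPhase_mul, boolSign_mul_self, one_pow, one_mul,
    Complex.ofReal_one, mul_one]
  have : (∑ x ∈ Finset.range (2 * p), ((v (2 * (x : ℤ)) : ℂ) + v (2 * (x : ℤ) + 1))) = 0 := by
    exact_mod_cast congrArg Complex.ofReal h0
  rw [this, mul_zero]

theorem norm_blochPotential_of_ne {p : ℕ} (hp : 0 < p) (a : ℝ) {v : ℤ → ℝ}
    (hv : ∀ x, v (x + ((2 * p : ℕ) : ℤ)) = v x) {n : ℕ} (hn : n < 2 * p) (hn1 : 1 ≤ n)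
    (hnp : n ≠ p) (s : Bool) :
    ‖blochPotential p a v (⟨n, hn⟩, s) (⟨2 * p - n, by omega⟩, s)‖ = coupling p a v n := by
  have hp' : (p : ℂ) ≠ 0 := by exact_mod_cast hp.ne'
  rw [blochPotential_apply, coupling, if_neg hnp]
  simp only [boolSign_mul_self, tau_two_mul_sub hp hn.le, bandPhase_two_mul_sub hp a hn.le,
    Complex.ofReal_one, one_mul]
  congr 1
  have h : ∀ q : ℕ, ((starRingEnd ℂ) (tau p n) * (starRingEnd ℂ) (tau p n)) ^ q
      * ((v (2 * (q : ℤ)) : ℂ) + v (2 * (q : ℤ) + 1)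
        * ((starRingEnd ℂ) (bandPhase p a n) * (starRingEnd ℂ) (bandPhase p a n)))
      = (v (2 * (q : ℤ)) : ℂ) * (starRingEnd ℂ) (tau p n) ^ (2 * q)
        + (v (2 * (q : ℤ) + 1) : ℂ) * (starRingEnd ℂ) (tau p n) ^ (2 * q)
          * (starRingEnd ℂ) (bandPhase p a n) ^ 2 := by
    intro q
    rw [pow_mul, sq]
    ring
  rw [Finset.sum_congr rfl fun q _ => h q, Finset.sum_add_distrib, ← Finset.sum_mul,
    sum_even_mul_conj_tau hp hv, sum_odd_mul_conj_tau hp hv]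
  field_simp

/-- The two states share multiplier and phase, so the phases cancel; their opposite signs contribute
the minus on the odd sites. -/
theorem norm_blochPotential_self {p : ℕ} (hp : 0 < p) (a : ℝ) {v : ℤ → ℝ}
    (hv : ∀ x, v (x + ((2 * p : ℕ) : ℤ)) = v x) (h : p < 2 * p) :
    ‖blochPotential p a v (⟨p, h⟩, true) (⟨p, h⟩, false)‖ = coupling p a v p := by
  have hp' : (p : ℂ) ≠ 0 := by exact_mod_cast hp.ne'
  have h0 := sum_even_mul_conj_tau hp hv p
  have h1 := sum_odd_mul_conj_tau hp hv p
  have hc : ∀ q : ℕ, (starRingEnd ℂ) (tau p p) ^ (2 * q) = 1 := fun q => by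
    rw [tau_self hp, pow_mul]; simp
  simp only [hc, mul_one] at h0 h1
  rw [tau_self hp] at h1
  rw [blochPotential_apply, coupling, if_pos rfl]
  simp only [conj_tau_mul_tau, conj_bandPhase_mul, one_pow, one_mul, mul_one,
    boolSign_mul_of_ne (Bool.noConfusion : true ≠ false), Complex.ofReal_neg, Complex.ofReal_one,
    mul_neg, ← sub_eq_add_neg]
  rw [Finset.sum_sub_distrib, h0, h1]
  congr 1
  field_simp

open Finset in
/-- First order splitting of the band edges at a gap that is closed for the zero potential. -/
theorem exists_abs_edge_sub_le {p : ℕ} (hp : 0 < p) {a : ℝ} (ha : 0 < a) {v : ℤ → ℝ}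
    (hv : ∀ x, v (x + ((2 * p : ℕ) : ℤ)) = v x)
    (h0 : ∑ x ∈ Finset.range (2 * p), (v (2 * (x : ℤ)) + v (2 * (x : ℤ) + 1)) = 0)
    {n : ℕ} (hn : n ∈ gapIndices p a) :
    ∃ μ C t₀ : ℝ, 0 < t₀ ∧ ∀ t : ℝ, 0 ≤ t → t ≤ t₀ →
      |edgeMinus p a (t • v) n - (μ - t * coupling p a v n)| ≤ C * t ^ 2 ∧
      |edgePlus p a (t • v) n - (μ + t * coupling p a v n)| ≤ C * t ^ 2 := by
  obtain ⟨hn1, hn2, hnp⟩ := hn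
  suffices h : ∃ (μ : ℝ) (i j : Fin (2 * p) × Bool), i ≠ j ∧ freeEigenvalue p a i = μ ∧
      freeEigenvalue p a j = μ ∧ (∀ k, k ≠ i → k ≠ j → freeEigenvalue p a k ≠ μ) ∧
      ‖blochPotential p a v i j‖ = coupling p a v n ∧
      #{k | freeEigenvalue p a k < μ} = 2 * n - 1 by
    obtain ⟨μ, i, j, hij, hi, hj, hne, hB, hr⟩ := h
    obtain ⟨C, t₀, ht₀, H⟩ := exists_abs_sort_eigenvalues_sub_le
      (blochPotential_isHermitian p a v) hij hi hj hne (blochPotential_apply_self a h0 i)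
      (blochPotential_apply_self a h0 j) hr
    refine ⟨μ, C, t₀, ht₀, fun t ht htt => ?_⟩
    obtain ⟨U, e, hU, hH, he⟩ := periodicEigenvalue_eq hp a v t
    have := H t ht htt hU hH
    rw [← he, ← he, hB, show 2 * n - 1 + 1 = 2 * n by omega] at this
    exact this
  -- For `n = p` (so `a = 1`) the pair has the same multiplier and opposite signs, at eigenvalue 0.
  -- Otherwise it is `n` and `2p - n` with a common sign, negative for `n < p` and positive for `n >
  -- p`.
  by_cases hnp' : n = p
  · subst hnp'
    obtain rfl := hnp rfl
    refine ⟨-bandRadius n 1 n, (⟨n, hn2⟩, true), (⟨n, hn2⟩, false), by simp, ?_, ?_, ?_,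
      norm_blochPotential_self hp 1 hv hn2, card_freeEigenvalue_lt_neg hp ha hn1 le_rfl⟩
    · rw [freeEigenvalue_true]; simp [bandRadius_self_one hp]
    · rw [freeEigenvalue_false]
    · rintro ⟨m, s⟩ h1 h2 h
      have hm : (m : ℕ) ≠ n := by
        intro hm
        cases s
        · exact h2 (Prod.ext (Fin.ext hm) rfl)
        · exact h1 (Prod.ext (Fin.ext hm) rfl)
      have := bandRadius_pos hp ha m.2.le hm
      rw [bandRadius_self_one hp] at h
      cases s
      · rw [freeEigenvalue_false] at h; linarith
      · rw [freeEigenvalue_true] at h; linarith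
  · have hpos := bandRadius_pos hp ha hn2.le hnp'
    have key : ∀ s : Bool, ∀ k : Fin (2 * p) × Bool, k ≠ (⟨n, hn2⟩, s) →
        k ≠ (⟨2 * p - n, by omega⟩, s) → freeEigenvalue p a k ≠ boolSign s * bandRadius p a n := by
      rintro s ⟨m, s'⟩ h1 h2 h
      have hm := bandRadius_nonneg p a m
      by_cases hs : s' = s
      · subst hs
        have h3 : bandRadius p a m = bandRadius p a n := by
          cases s' <;> simpa [freeEigenvalue, boolSign] using h
        rcases (bandRadius_eq_iff hp ha m.2.le hn2.le).1 h3 with h4 | h4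
        · exact h1 (Prod.ext (Fin.ext h4) rfl)
        · exact h2 (Prod.ext (Fin.ext h4) rfl)
      · cases s <;> cases s' <;> simp_all [freeEigenvalue, boolSign] <;> linarith
    have hne : ∀ s : Bool, ((⟨n, hn2⟩, s) : Fin (2 * p) × Bool) ≠ (⟨2 * p - n, by omega⟩, s) := by
      intro s h
      simp only [Prod.mk.injEq, Fin.mk.injEq, and_true] at h
      omega
    have hval : ∀ s : Bool, freeEigenvalue p a (⟨2 * p - n, by omega⟩, s)
        = boolSign s * bandRadius p a n := by
      intro s
      simp only [freeEigenvalue, bandRadius_two_mul_sub hp a hn2.le]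
    obtain ⟨s, hs⟩ : ∃ s, #{k | freeEigenvalue p a k < boolSign s * bandRadius p a n}
        = 2 * n - 1 := by
      rcases lt_or_gt_of_ne hnp' with h | h
      · exact ⟨false, by simpa [boolSign] using card_freeEigenvalue_lt_neg hp ha hn1 h.le⟩
      · exact ⟨true, by simpa [boolSign] using card_freeEigenvalue_lt_pos hp ha h hn2⟩
    exact ⟨boolSign s * bandRadius p a n, (⟨n, hn2⟩, s), (⟨2 * p - n, by omega⟩, s), hne s, rfl,
      hval s, key s, norm_blochPotential_of_ne hp a hv hn2 hn1 hnp' s, hs⟩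

end Nanotube

/-! ### Fourier coefficients of the potentials -/

namespace Nanotube

theorem halfPeriod_pos {ps : ℕ} (hps : 1 ≤ ps) : 0 < halfPeriod ps := by
  unfold halfPeriod
  split_ifs with h
  · obtain ⟨r, rfl⟩ := h
    omega
  · omega

theorem periodic_two_mul_halfPeriod {ps : ℕ} {v : ℤ → ℝ} (hv : ∀ n, v (n + ps) = v n) (x : ℤ) :
    v (x + ((2 * halfPeriod ps : ℕ) : ℤ)) = v x := by
  unfold halfPeriod
  split_ifs with h
  · rw [Nat.two_mul_div_two_of_even h, hv]
  · rw [two_mul, Nat.cast_add, ← add_assoc, hv, hv]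

theorem sum_Icc_even_add_odd (p : ℕ) (v : ℤ → ℝ) :
    ∑ m ∈ Finset.Icc 1 p, (v (2 * (m : ℤ)) + v (2 * (m : ℤ) - 1))
      = ∑ n ∈ Finset.Icc 1 (2 * p), v (n : ℤ) := by
  induction p with
  | zero => simp
  | succ p ih =>
    rw [Finset.sum_Icc_succ_top (by omega), ih, mul_add, mul_one,
      Finset.sum_Icc_succ_top (by omega), Finset.sum_Icc_succ_top (by omega)]
    have h1 : (2 * ((p + 1 : ℕ) : ℤ) - 1) = ((2 * p + 1 : ℕ) : ℤ) := by push_cast; ring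
    have h2 : 2 * ((p + 1 : ℕ) : ℤ) = ((2 * p + 1 + 1 : ℕ) : ℤ) := by push_cast; ring
    rw [h1, h2]
    ring

theorem conj_fourierVec {p : ℕ} (n m : ℕ) :
    (starRingEnd ℂ) (fourierVec p n m) = 1 / (2 * p) * (starRingEnd ℂ) (tau p n) ^ (2 * m) := by
  simp only [fourierVec, map_mul, map_pow, map_div₀, map_one, map_natCast, map_ofNat]

/-- As `τ_p² = 1`, both coefficients are plain averages up to a common factor. Consequently `v̂_p^0
- v̂_p^1` is twice either of them up to sign. -/
theorem hat_zero_add_hat_one_self {p : ℕ} (hp : 0 < p) {v : ℤ → ℝ}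
    (h : ∑ n ∈ Finset.Icc 1 (2 * p), v (n : ℤ) = 0) : hat p v 0 p + hat p v 1 p = 0 := by
  rw [← sum_Icc_even_add_odd] at h
  have hc : ∀ m : ℕ, (starRingEnd ℂ) (fourierVec p p m) = 1 / (2 * p) := fun m => by
    rw [conj_fourierVec, tau_self hp, pow_mul]
    simp
  simp only [hat, hc]
  rw [← Finset.sum_mul, ← Finset.sum_mul, ← add_mul, ← Finset.sum_add_distrib]
  have := congrArg Complex.ofReal h
  push_cast at this
  simp only [Fin.val_zero, Fin.val_one, Nat.cast_zero, Nat.cast_one, sub_zero]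
  rw [this, zero_mul]

theorem sum_range_even_add_odd_eq_zero {p : ℕ} (hp : 0 < p) {v : ℤ → ℝ}
    (hv : ∀ x, v (x + ((2 * p : ℕ) : ℤ)) = v x)
    (h : ∑ n ∈ Finset.Icc 1 (2 * p), v (n : ℤ) = 0) :
    ∑ x ∈ Finset.range (2 * p), (v (2 * (x : ℤ)) + v (2 * (x : ℤ) + 1)) = 0 := by
  have h0 := sum_even_mul_conj_tau hp hv p
  have h1 := sum_odd_mul_conj_tau hp hv p
  have hc : ∀ q : ℕ, (starRingEnd ℂ) (tau p p) ^ (2 * q) = 1 := fun q => by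
    rw [tau_self hp, pow_mul]; simp
  simp only [hc, mul_one] at h0 h1
  rw [tau_self hp] at h1
  apply Complex.ofReal_injective
  push_cast
  rw [Finset.sum_add_distrib, h0, h1]
  linear_combination 4 * (p : ℂ) * hat_zero_add_hat_one_self hp h

/-- Reality of `v`; it carries the conditions defining `frakX` from `n < p` to `n > p`. -/
theorem hat_two_mul_sub {p : ℕ} (hp : 0 < p) (v : ℤ → ℝ) (j : Fin 2) {n : ℕ} (hn : n ≤ 2 * p) :
    hat p v j (2 * p - n) = (starRingEnd ℂ) (hat p v j n) := by
  simp only [hat, conj_fourierVec, tau_two_mul_sub hp hn, map_sum, map_mul, map_pow, map_div₀,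
    map_one, map_natCast, map_ofNat, Complex.conj_ofReal]

theorem tau_ne_one {p : ℕ} (hp : 0 < p) {n : ℕ} (hn1 : 1 ≤ n) (hn : n < 2 * p) :
    tau p n ≠ 1 := by
  intro h
  have h0 : tau p 0 = 1 := by simp [tau]
  have := tau_inj hp hn (by omega) (h.trans h0.symm)
  omega

theorem tau_ne_neg_one {p : ℕ} (hp : 0 < p) {n : ℕ} (hn : n < 2 * p) (hnp : n ≠ p) :
    tau p n ≠ -1 := fun h =>
  hnp (tau_inj hp hn (by omega) (h.trans (tau_self hp).symm))

theorem tau_pow_self {p : ℕ} (hp : 0 < p) (n : ℕ) : tau p n ^ p = (-1) ^ n := by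
  have hp' : (p : ℂ) ≠ 0 := by exact_mod_cast hp.ne'
  rw [tau, ← Complex.exp_nat_mul, ← Complex.exp_pi_mul_I, ← Complex.exp_nat_mul]
  congr 1
  field_simp

theorem sum_Icc_periodic_add {p : ℕ} {g : ℕ → ℂ} (hg : ∀ q, g (q + p) = g q) (r : ℕ) :
    ∑ q ∈ Finset.Icc 1 p, g (q + r) = ∑ q ∈ Finset.Icc 1 p, g q := by
  induction r with
  | zero => rfl
  | succ r ih =>
    rw [← ih]
    have h1 := Finset.sum_Icc_succ_top (Nat.le_add_left 1 p) fun q => g (q + r)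
    have h2 := Finset.sum_Ioc_add_eq_sum_Icc (f := fun q => g (q + r)) (Nat.le_add_left 1 p)
    have h3 : ∑ q ∈ Finset.Ioc 1 (p + 1), g (q + r) = ∑ q ∈ Finset.Icc 1 p, g (q + (r + 1)) := by
      refine (Finset.sum_bij (fun q _ => q + 1) ?_ ?_ ?_ ?_).symm
      · intro q hq
        simp only [Finset.mem_Icc, Finset.mem_Ioc] at hq ⊢
        omega
      · intro q _ q' _ h
        omega
      · intro q hq
        simp only [Finset.mem_Ioc] at hq
        exact ⟨q - 1, by simp only [Finset.mem_Icc]; omega, by omega⟩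
      · intro q _
        congr 1
        ring
    have h4 : g (p + 1 + r) = g (1 + r) := by
      rw [← hg (1 + r)]
      congr 1
      ring
    rw [h3] at h2
    rw [h4] at h1
    exact add_right_cancel (h2.trans h1)

/-- With `p = 2r + 1`, periodicity gives `v_{2m-1} = v_{2(m+r)}`. So `v^1` is `v^0` shifted by `r`,
and the shift multiplies the coefficient by `τ_n^{2r} = τ_n^p τ_n^{-1}`. -/
theorem hat_one_eq_of_odd {p : ℕ} (hp : 0 < p) (hodd : Odd p) {v : ℤ → ℝ}
    (hv : ∀ x, v (x + p) = v x) (n : ℕ) :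
    hat p v 1 n = (-1) ^ n * (tau p n)⁻¹ * hat p v 0 n := by
  obtain ⟨r, hr⟩ := hodd
  set σ := (starRingEnd ℂ) (tau p n) with hσ
  have hσp : σ ^ (2 * p) = 1 := by rw [hσ, ← map_pow, tau_pow_two_mul hp, map_one]
  have hσr : (-1) ^ n * (tau p n)⁻¹ * σ ^ (2 * r) = 1 := by
    have h1 : σ ^ p = (-1) ^ n := by rw [hσ, ← map_pow, tau_pow_self hp]; simp
    have h2 : σ ^ p = σ ^ (2 * r) * σ := by rw [← pow_succ, ← hr]
    have h3 : ((-1 : ℂ) ^ n) * (-1) ^ n = 1 := by rw [← mul_pow]; simp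
    have h4 : (tau p n)⁻¹ = σ := (conj_tau_eq_inv p n).symm
    rw [h4, mul_assoc, mul_comm σ, ← h2, h1, h3]
  set g : ℕ → ℂ := fun m => (v (2 * (m : ℤ)) : ℂ) * σ ^ (2 * m) with hg
  have hgp : ∀ q, g (q + p) = g q := by
    intro q
    have h1 : (2 * ((q + p : ℕ) : ℤ)) = 2 * (q : ℤ) + p + p := by push_cast; ring
    simp only [hg]
    rw [h1, hv, hv, mul_add 2 q p, pow_add, hσp, mul_one]
  have h0 : hat p v 0 n = 1 / (2 * p) * ∑ m ∈ Finset.Icc 1 p, g m := by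
    rw [hat, Finset.mul_sum]
    refine Finset.sum_congr rfl fun m _ => ?_
    rw [conj_fourierVec]
    simp only [Fin.val_zero, Nat.cast_zero, sub_zero, hg]
    ring
  rw [h0, ← sum_Icc_periodic_add hgp r, hat, Finset.mul_sum, Finset.mul_sum]
  refine Finset.sum_congr rfl fun m _ => ?_
  have h1 : 2 * ((m + r : ℕ) : ℤ) = (2 * (m : ℤ) - ((1 : Fin 2) : ℕ)) + p := by
    rw [hr]
    push_cast [Fin.val_one]
    ring
  rw [conj_fourierVec]
  simp only [hg]
  rw [h1, hv, mul_add 2 m r, pow_add]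
  linear_combination (-((v (2 * (m : ℤ) - ((1 : Fin 2) : ℕ)) : ℂ) * (1 / (2 * p))
    * σ ^ (2 * m))) * hσr

theorem exp_two_I_arg (p : ℕ) (a : ℝ) (n : ℕ) (h : (a : ℂ) + tau p n ≠ 0) :
    Complex.exp (2 * Complex.I * Complex.arg ((a : ℂ) + tau p n)) = bandPhase p a n ^ 2 := by
  have h1 : bandPhase p a n = Complex.exp (Complex.arg ((a : ℂ) + tau p n) * Complex.I) := by
    have h2 := Complex.norm_mul_exp_arg_mul_I ((a : ℂ) + tau p n)
    have h3 := bandRadius_mul_bandPhase p a n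
    have h4 : (bandRadius p a n : ℂ) ≠ 0 := by simpa [bandRadius] using h
    exact mul_left_cancel₀ h4 (h3.trans h2.symm)
  rw [h1, ← Complex.exp_nat_mul]
  congr 1
  push_cast
  ring

theorem add_tau_ne_zero {p : ℕ} (hp : 0 < p) {a : ℝ} (ha : 0 < a) {n : ℕ} (hn : n < 2 * p)
    (hnp : n ≠ p) : (a : ℂ) + tau p n ≠ 0 :=
  norm_pos_iff.1 (bandRadius_pos hp ha hn.le hnp)

/-- The last factor is `(a + 1)(τ_n + 1)` for `ε = 1` and `(a - 1)(τ_n - 1)` for `ε = -1`, which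
shows at once when the left side vanishes. -/
theorem one_add_bandPhase_sq_mul (p : ℕ) (a : ℝ) (n : ℕ) (ε : ℂ) :
    (1 + ε * bandPhase p a n ^ 2 * (tau p n)⁻¹) * ((bandRadius p a n : ℂ) ^ 2 * tau p n)
      = (a + tau p n) * (a * tau p n + 1 + ε * (a + tau p n)) := by
  have h1 : (bandRadius p a n : ℂ) ^ 2 = (a + tau p n) * (a + (tau p n)⁻¹) := by
    rw [bandRadius, ← Complex.mul_conj', map_add, Complex.conj_ofReal, conj_tau_eq_inv]
  have h2 := bandRadius_mul_bandPhase p a n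
  have h3 := mul_inv_cancel₀ (tau_ne_zero p n)
  linear_combination tau p n * h1 + (a + tau p n) * h3 + ε * bandPhase p a n ^ 2
    * bandRadius p a n ^ 2 * h3 + ε * (bandRadius p a n * bandPhase p a n + (a + tau p n)) * h2

theorem psi_eq_of_odd {p : ℕ} (hp : 0 < p) (hodd : Odd p) {a : ℝ} (ha : 0 < a) {v : ℤ → ℝ}
    (hv : ∀ x, v (x + p) = v x) {n : ℕ} (hn : n < 2 * p) (hnp : n ≠ p) :
    psi p a v n = ‖hat p v 0 n‖ * ‖1 + (-1) ^ n * bandPhase p a n ^ 2 * (tau p n)⁻¹‖ := by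
  rw [psi, if_neg hnp, exp_two_I_arg p a n (add_tau_ne_zero hp ha hn hnp),
    hat_one_eq_of_odd hp hodd hv, ← norm_mul]
  congr 1
  ring

/-- The phases in `coupling` and `psi` differ. After substituting the relation between the two
coefficients, the remaining factors are complex conjugates, so the moduli agree. -/
theorem coupling_eq_psi_of_odd {p : ℕ} (hp : 0 < p) (hodd : Odd p) {a : ℝ} (ha : 0 < a)
    {v : ℤ → ℝ} (hv : ∀ x, v (x + p) = v x) {n : ℕ} (hn : n < 2 * p) (hnp : n ≠ p) :
    coupling p a v n = psi p a v n := by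
  rw [psi_eq_of_odd hp hodd ha hv hn hnp, coupling, if_neg hnp, hat_one_eq_of_odd hp hodd hv,
    ← Complex.norm_conj (1 + _), ← norm_mul]
  congr 1
  have h := mul_inv_cancel₀ (tau_ne_zero p n)
  simp only [map_add, map_mul, map_pow, map_one, map_neg, map_inv₀, conj_tau_eq_inv, inv_inv]
  linear_combination hat p v 0 n * (-1) ^ n * (starRingEnd ℂ) (bandPhase p a n) ^ 2 * tau p n * h

theorem hat_ne_zero_of_odd {ps : ℕ} (hps : 1 ≤ ps) (hodd : Odd ps) {v : ℤ → ℝ}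
    (hv : v ∈ frakX ps) {n : ℕ} (hn1 : 1 ≤ n) (hn : n < 2 * ps) (hnp : n ≠ ps) :
    hat ps v 0 n ≠ 0 := by
  have h := hv.2.2 hodd
  have hp : halfPeriod ps = ps := if_neg (Nat.not_even_iff_odd.2 hodd)
  rw [hp] at h
  rcases lt_or_gt_of_ne hnp with h1 | h1
  · exact h n hn1 h1
  · have h2 := h (2 * ps - n) (by omega) (by omega)
    rw [hat_two_mul_sub hps v 0 hn.le] at h2
    exact fun h3 => h2 (by rw [h3, map_zero])

theorem psi_ne_zero_of_odd {ps : ℕ} (hps : 1 ≤ ps) (hodd : Odd ps) {a : ℝ} (ha : 0 < a)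
    {v : ℤ → ℝ} (hv : v ∈ frakX ps) {n : ℕ} (hn1 : 1 ≤ n) (hn : n < 2 * ps) (hnp : n ≠ ps)
    (h : a ≠ 1 ∨ Even n) : psi ps a v n ≠ 0 := by
  have hp : halfPeriod ps = ps := if_neg (Nat.not_even_iff_odd.2 hodd)
  rw [psi_eq_of_odd hps hodd ha hv.1.1 hn hnp]
  refine mul_ne_zero (norm_ne_zero_iff.2 (hat_ne_zero_of_odd hps hodd hv hn1 hn hnp))
    (norm_ne_zero_iff.2 fun h0 => ?_)
  have h1 := one_add_bandPhase_sq_mul ps a n ((-1) ^ n)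
  rw [h0, zero_mul] at h1
  have h2 := (mul_eq_zero.1 h1.symm).resolve_left (add_tau_ne_zero hps ha hn hnp)
  rcases Nat.even_or_odd n with he | ho
  · rw [he.neg_one_pow] at h2
    have h3 : ((a : ℂ) + 1) * (tau ps n + 1) = 0 := by linear_combination h2
    rcases mul_eq_zero.1 h3 with h4 | h4
    · have : a + 1 = 0 := by exact_mod_cast h4
      linarith
    · exact tau_ne_neg_one hps hn hnp (eq_neg_of_add_eq_zero_left h4)
  · rw [ho.neg_one_pow] at h2
    have h3 : ((a : ℂ) - 1) * (tau ps n - 1) = 0 := by linear_combination h2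
    rcases mul_eq_zero.1 h3 with h4 | h4
    · have h5 : a = 1 := by exact_mod_cast sub_eq_zero.1 h4
      rcases h with h | h
      · exact h h5
      · exact (Nat.not_even_iff_odd.2 ho) h
    · exact tau_ne_one hps hn1 hn (sub_eq_zero.1 h4)

theorem psi_one_eq_zero_of_odd {ps : ℕ} (hps : 1 ≤ ps) (hodd : Odd ps)
    {v : ℤ → ℝ} (hv : ∀ x, v (x + ps) = v x) {n : ℕ} (hn : n < 2 * ps) (ho : Odd n) :
    psi ps 1 v n = 0 := by
  by_cases hnp : n = ps
  · subst hnp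
    rw [psi, if_pos rfl, hat_one_eq_of_odd hps hodd hv, tau_self hps, ho.neg_one_pow]
    norm_num
  · rw [psi_eq_of_odd hps hodd one_pos hv hn hnp]
    refine mul_eq_zero_of_right _ (norm_eq_zero.2 ?_)
    have h1 := one_add_bandPhase_sq_mul ps 1 n ((-1) ^ n)
    rw [ho.neg_one_pow] at h1 ⊢
    refine (mul_eq_zero.1 (h1.trans ?_)).resolve_right ?_
    · push_cast
      ring
    · refine mul_ne_zero (pow_ne_zero _ ?_) (tau_ne_zero _ _)
      exact_mod_cast (bandRadius_pos hps one_pos hn.le hnp).ne'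

/-! ### Gap opening and asymptotics of the edges -/

open Filter Topology in
theorem eventually_gap_nonempty {p : ℕ} (hp : 0 < p) {a : ℝ} (ha : 0 < a) {v : ℤ → ℝ}
    (hv : ∀ x, v (x + ((2 * p : ℕ) : ℤ)) = v x)
    (h0 : ∑ n ∈ Finset.Icc 1 (2 * p), v (n : ℤ) = 0)
    {n : ℕ} (hn : n ∈ gapIndices p a) (hB : coupling p a v n ≠ 0) :
    ∀ᶠ t in 𝓝[>] (0 : ℝ), (gap p a (t • v) n).Nonempty := by
  obtain ⟨μ, C, t₀, ht₀, H⟩ :=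
    exists_abs_edge_sub_le hp ha hv (sum_range_even_add_odd_eq_zero hp hv h0) hn
  have hB0 : 0 < coupling p a v n := by
    refine lt_of_le_of_ne ?_ hB.symm
    unfold coupling
    split_ifs <;> exact norm_nonneg _
  set B := coupling p a v n
  have hC : 0 < |C| + 1 := by positivity
  -- In this range the linear splitting `tB` on each side dominates the error `Ct²`; `|C| + 1` is
  -- used because `C` has no known sign.
  filter_upwards [Ioo_mem_nhdsGT (show 0 < min t₀ (B / (|C| + 1)) by positivity)] with t ht
  obtain ⟨ht1, ht2⟩ := ht
  obtain ⟨h1, h2⟩ := H t ht1.le (ht2.le.trans (min_le_left _ _))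
  have h3 : t * (|C| + 1) < B := (lt_div_iff₀ hC).1 (ht2.trans_le (min_le_right _ _))
  rw [gap, Set.nonempty_Ioo]
  have h4 : C * t ^ 2 < t * B := by
    have : C ≤ |C| := le_abs_self C
    nlinarith [mul_pos ht1 ht1]
  linarith [(abs_le.1 h1).2, (abs_le.1 h2).1]

open Filter Topology in
theorem exists_forall_gap_nonempty {p : ℕ} {a : ℝ} {v : ℤ → ℝ} {P : ℕ → Prop}
    (h : ∀ n, P n → n < 2 * p → ∀ᶠ t in 𝓝[>] (0 : ℝ), (gap p a (t • v) n).Nonempty) :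
    ∃ t₀ : ℝ, 0 < t₀ ∧ ∀ t : ℝ, 0 < t → t < t₀ → ∀ n, P n → n < 2 * p →
      (gap p a (t • v) n).Nonempty := by
  have h1 : ∀ᶠ t in 𝓝[>] (0 : ℝ), ∀ n ∈ Set.Iio (2 * p), P n → (gap p a (t • v) n).Nonempty := by
    rw [eventually_all_finite (Set.finite_Iio _)]
    intro n hn
    by_cases hP : P n
    · filter_upwards [h n hP hn] with t ht _ using ht
    · exact Eventually.of_forall fun t h => absurd h hP
  obtain ⟨t₀, ht₀, H⟩ := mem_nhdsGT_iff_exists_Ioo_subset.1 h1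
  exact ⟨t₀, ht₀, fun t h2 h3 n hP hn => H ⟨h2, h3⟩ n hn hP⟩

theorem hat_of_even {ps : ℕ} (hps : 1 ≤ ps) (heven : Even ps) {v : ℤ → ℝ}
    (hv : v ∈ frakX ps) {n : ℕ} (hn1 : 1 ≤ n) (hn : n < 2 * halfPeriod ps)
    (hnp : n ≠ halfPeriod ps) :
    hat (halfPeriod ps) v 0 n + hat (halfPeriod ps) v 1 n ≠ 0 ∧
      hat (halfPeriod ps) v 0 n * hat (halfPeriod ps) v 1 n = 0 := by
  have hp := halfPeriod_pos hps
  set p := halfPeriod ps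
  have h := (hv.2.1 heven).1
  rcases lt_or_gt_of_ne hnp with h1 | h1
  · exact h n hn1 h1
  · have h2 := h (2 * p - n) (by omega) (by omega)
    rw [hat_two_mul_sub hp v 0 hn.le, hat_two_mul_sub hp v 1 hn.le, ← map_add, ← map_mul] at h2
    exact ⟨fun h3 => h2.1 (by rw [h3, map_zero]), by simpa only [map_eq_zero] using h2.2⟩

/-- When one coefficient vanishes, the unimodular factor in front of the other does not affect the
modulus. -/
theorem coupling_eq_xi {p : ℕ} (a : ℝ) {v : ℤ → ℝ} {n : ℕ}
    (h : n ≠ p → hat p v 0 n * hat p v 1 n = 0) : coupling p a v n = xi p v n := by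
  unfold coupling xi
  split_ifs with hnp
  · rfl
  · rcases mul_eq_zero.1 (h hnp) with h0 | h0
    · simp [h0, norm_bandPhase, norm_tau]
    · simp [h0]

open Filter Topology Asymptotics in
theorem edge_isBigO {p : ℕ} (hp : 0 < p) {a : ℝ} (ha : 0 < a) {v : ℤ → ℝ}
    (hv : ∀ x, v (x + ((2 * p : ℕ) : ℤ)) = v x)
    (h0 : ∑ n ∈ Finset.Icc 1 (2 * p), v (n : ℤ) = 0)
    {n : ℕ} (hn : n ∈ gapIndices p a) :
    (fun t : ℝ => edgePlus p a (t • v) n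
        - (edgePlus p a ((0 : ℝ) • v) n + t * coupling p a v n)) =O[𝓝[>] 0] (fun t : ℝ => t ^ 2) ∧
    (fun t : ℝ => edgeMinus p a (t • v) n
        - (edgeMinus p a ((0 : ℝ) • v) n - t * coupling p a v n)) =O[𝓝[>] 0] (fun t : ℝ => t ^ 2) ∧
    (fun t : ℝ => (edgePlus p a (t • v) n - edgeMinus p a (t • v) n)
        - t * (2 * coupling p a v n)) =O[𝓝[>] 0] (fun t : ℝ => t ^ 2) := by
  obtain ⟨μ, C, t₀, ht₀, H⟩ :=
    exists_abs_edge_sub_le hp ha hv (sum_range_even_add_odd_eq_zero hp hv h0) hn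
  -- At `t = 0` the estimate identifies `μ` with both unperturbed edges.
  have hz := H 0 le_rfl ht₀.le
  simp only [zero_mul, sub_zero, add_zero, ne_eq, OfNat.ofNat_ne_zero, not_false_eq_true,
    zero_pow, mul_zero, abs_nonpos_iff, sub_eq_zero] at hz
  have hmem : Set.Ioo 0 t₀ ∈ 𝓝[>] (0 : ℝ) := Ioo_mem_nhdsGT ht₀
  have hplus : (fun t : ℝ => edgePlus p a (t • v) n
      - (edgePlus p a ((0 : ℝ) • v) n + t * coupling p a v n))
        =O[𝓝[>] 0] (fun t : ℝ => t ^ 2) := by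
    refine IsBigO.of_bound C ?_
    filter_upwards [hmem] with t ht
    rw [hz.2, Real.norm_eq_abs, Real.norm_of_nonneg (sq_nonneg t)]
    exact (H t ht.1.le ht.2.le).2
  have hminus : (fun t : ℝ => edgeMinus p a (t • v) n
      - (edgeMinus p a ((0 : ℝ) • v) n - t * coupling p a v n))
        =O[𝓝[>] 0] (fun t : ℝ => t ^ 2) := by
    refine IsBigO.of_bound C ?_
    filter_upwards [hmem] with t ht
    rw [hz.1, Real.norm_eq_abs, Real.norm_of_nonneg (sq_nonneg t)]
    exact (H t ht.1.le ht.2.le).1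
  refine ⟨hplus, hminus, (hplus.sub hminus).congr_left fun t => ?_⟩
  rw [hz.1, hz.2]
  ring

/-! ### Explicit members of `frakX` -/

theorem sum_conj_fourierVec {p : ℕ} (hp : 0 < p) {n : ℕ} (hn1 : 1 ≤ n) (hn : n < p) :
    ∑ m ∈ Finset.Icc 1 p, (starRingEnd ℂ) (fourierVec p n m) = 0 := by
  have hne : (starRingEnd ℂ) (tau p n) ^ 2 ≠ 1 := by
    rw [← map_pow]
    intro h
    rw [← map_one (starRingEnd ℂ), (starRingEnd ℂ).injective.eq_iff] at h
    rcases sq_eq_sq_iff_eq_or_eq_neg.1 (h.trans (one_pow 2).symm) with h | h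
    · exact tau_ne_one hp hn1 (by omega) h
    · exact tau_ne_neg_one hp (by omega) hn.ne h
  have hper : ∀ q, ((starRingEnd ℂ) (tau p n) ^ 2) ^ (q + p)
      = ((starRingEnd ℂ) (tau p n) ^ 2) ^ q := by
    intro q
    rw [pow_add, ← pow_mul _ 2 p, ← map_pow _ _ (2 * p), tau_pow_two_mul hp, map_one, mul_one]
  have h := sum_range_two_mul_of_periodic hper
  have h1 : ((starRingEnd ℂ) (tau p n) ^ 2) ^ (2 * p) = 1 := by
    have h2 := hper 0
    rw [zero_add, pow_zero] at h2
    rw [two_mul, hper, h2]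
  rw [geom_sum_eq hne, h1, sub_self, zero_div] at h
  simp only [conj_fourierVec, pow_mul, ← Finset.mul_sum]
  rw [(mul_eq_zero.1 h.symm).resolve_left two_ne_zero, mul_zero]

theorem frakX_nonempty_of_even {ps : ℕ} (hps : 1 ≤ ps) (heven : Even ps) :
    (frakX ps).Nonempty := by
  have hp := halfPeriod_pos hps
  have hps2 : ps = 2 * halfPeriod ps := by
    rw [halfPeriod, if_pos heven, Nat.two_mul_div_two_of_even heven]
  set p := halfPeriod ps with hpd
  -- A unit mass on the even sites has all coefficients equal to `1/(2p)`; the constant `-1/p` on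
  -- the odd sites restores zero mean and is invisible to the modes `1 ≤ n < p`.
  set v : ℤ → ℝ := fun x => if Even x then (if (ps : ℤ) ∣ x then 1 else 0) else -(1 / p) with hv
  have hve : ∀ m ∈ Finset.Icc 1 p, v (2 * (m : ℤ)) = if m = p then 1 else 0 := by
    intro m hm
    rw [Finset.mem_Icc] at hm
    have h1 : (ps : ℤ) ∣ 2 * (m : ℤ) ↔ m = p := by
      rw [hps2]
      push_cast
      rw [mul_dvd_mul_iff_left two_ne_zero, Int.natCast_dvd_natCast]
      constructor
      · intro h
        exact le_antisymm hm.2 (Nat.le_of_dvd (by omega) h)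
      · rintro rfl
        rfl
    simp only [hv, even_two_mul, if_true, h1]
  have hvo : ∀ m : ℤ, v (2 * m - 1) = -(1 / p) := by
    intro m
    have h1 : ¬ Even (2 * m - 1) := by simp
    simp only [hv, if_neg h1]
  have h0 : ∀ n, hat p v 0 n = 1 / (2 * p) := by
    intro n
    rw [hat, Finset.sum_eq_single p]
    · simp only [Fin.val_zero, Nat.cast_zero, sub_zero]
      rw [hve p (by simp; omega), conj_fourierVec, ← map_pow, tau_pow_two_mul hp]
      simp
    · intro m hm hmp
      simp only [Fin.val_zero, Nat.cast_zero, sub_zero]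
      rw [hve m hm, if_neg hmp]
      simp
    · intro h
      simp at h
      omega
  have h1 : ∀ n, 1 ≤ n → n < p → hat p v 1 n = 0 := by
    intro n hn1 hn
    simp only [hat, Fin.val_one, Nat.cast_one, hvo]
    rw [← Finset.mul_sum, sum_conj_fourierVec hp hn1 hn, mul_zero]
  refine ⟨v, ⟨fun n => ?_, ?_⟩, fun _ => ⟨fun n hn1 hn => ?_, ?_⟩, fun ho => ?_⟩
  · have h2 : Even (n + (ps : ℤ)) ↔ Even n := by
      rw [Int.even_add]
      simp [heven]
    simp only [hv, h2, dvd_add_self_right]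
  · rw [← hpd, ← sum_Icc_even_add_odd, Finset.sum_add_distrib, Finset.sum_congr rfl hve]
    simp only [hvo]
    have : 1 ≤ p := hp
    have hpr : (p : ℝ) ≠ 0 := by exact_mod_cast hp.ne'
    simp [this, hpr]
  · rw [h0, h1 n hn1 hn]
    simpa using hp.ne'
  · rw [h0]
    simpa using hp.ne'
  · exact absurd heven (Nat.not_even_iff_odd.2 ho)

theorem frakX_nonempty_of_odd {ps : ℕ} (hodd : Odd ps) : (frakX ps).Nonempty := by
  have hp : 0 < ps := hodd.pos
  have hh : halfPeriod ps = ps := if_neg (Nat.not_even_iff_odd.2 hodd)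
  -- A periodic unit mass minus its mean. Since `ps` is odd, among the even sites `2m` with `1 ≤ m ≤
  -- ps` it sits only at `m = ps`, and the constant does not affect the nonzero modes.
  set v : ℤ → ℝ := fun x => (if (ps : ℤ) ∣ x then 1 else 0) - 1 / ps with hv
  refine ⟨v, ⟨fun n => ?_, ?_⟩, fun he => absurd he (Nat.not_even_iff_odd.2 hodd),
    fun _ n hn1 hn => ?_⟩
  · simp only [hv, dvd_add_self_right]
  · rw [hh]
    simp only [hv, Finset.sum_sub_distrib, Int.natCast_dvd_natCast]
    rw [← Finset.sum_filter]
    have : ((Finset.Icc 1 (2 * ps)).filter fun n => ps ∣ n) = {ps, 2 * ps} := by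
      ext n
      simp only [Finset.mem_filter, Finset.mem_Icc, Finset.mem_insert, Finset.mem_singleton]
      constructor
      · rintro ⟨⟨h1, h2⟩, c, rfl⟩
        have hc2 : c ≤ 2 := by
          by_contra! h
          nlinarith
        interval_cases c
        · omega
        · simp
        · right; ring
      · rintro (rfl | rfl)
        · exact ⟨by omega, dvd_rfl⟩
        · exact ⟨by omega, dvd_mul_left _ _⟩
    rw [this, Finset.sum_pair (by omega)]
    have hpr : (ps : ℝ) ≠ 0 := by exact_mod_cast hp.ne'
    simp
    field_simp
    ring
  · rw [hh] at hn ⊢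
    have : hat ps v 0 n = 1 / (2 * ps) := by
      have h1 : ∀ m ∈ Finset.Icc 1 ps, (v (2 * (m : ℤ) - (((0 : Fin 2) : ℕ) : ℤ)) : ℂ)
          * (starRingEnd ℂ) (fourierVec ps n m)
          = (if m = ps then (starRingEnd ℂ) (fourierVec ps n m) else 0)
            - 1 / ps * (starRingEnd ℂ) (fourierVec ps n m) := by
        intro m hm
        rw [Finset.mem_Icc] at hm
        have h2 : (ps : ℤ) ∣ 2 * (m : ℤ) ↔ m = ps := by
          rw [show (2 * (m : ℤ)) = ((2 * m : ℕ) : ℤ) by push_cast; rfl, Int.natCast_dvd_natCast,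
            Nat.Coprime.dvd_mul_left hodd.coprime_two_right]
          constructor
          · intro h
            exact le_antisymm hm.2 (Nat.le_of_dvd (by omega) h)
          · rintro rfl
            rfl
        simp only [hv, Fin.val_zero, Nat.cast_zero, sub_zero, h2]
        split_ifs <;> push_cast <;> ring
      rw [hat, Finset.sum_congr rfl h1, Finset.sum_sub_distrib, ← Finset.mul_sum,
        sum_conj_fourierVec hp hn1 hn, Finset.sum_ite_eq', if_pos (by simp; omega),
        conj_fourierVec, ← map_pow, tau_pow_two_mul hp]
      simp
    rw [this]
    simpa using hp.ne'

end Nanotube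

/-! ### Assembly of the proposition -/

open Nanotube in
theorem proposition2p3 (ps : ℕ) (hps : 1 ≤ ps) :
    (2 ≤ ps → (Nanotube.frakX ps).Nonempty) ∧
    ∀ (N : ℕ) (_ : 0 < N) (b : ℝ) (k : ℤ) (_ : Nanotube.ck N b k ≠ 0) (p : ℕ)
      (_ : p = Nanotube.halfPeriod ps) (a : ℝ) (_ : a = 2 * |Nanotube.ck N b k|)
      (v : ℤ → ℝ) (_ : v ∈ Nanotube.frakX ps),
      (Even ps → ∀ n ∈ Nanotube.gapIndices p a,
        0 < Nanotube.xi p v n ∧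
        (fun t : ℝ => Nanotube.edgePlus p a (t • v) n
            - (Nanotube.edgePlus p a ((0 : ℝ) • v) n + t * Nanotube.xi p v n))
          =O[nhdsWithin 0 (Set.Ioi 0)] (fun t : ℝ => t ^ 2) ∧
        (fun t : ℝ => Nanotube.edgeMinus p a (t • v) n
            - (Nanotube.edgeMinus p a ((0 : ℝ) • v) n - t * Nanotube.xi p v n))
          =O[nhdsWithin 0 (Set.Ioi 0)] (fun t : ℝ => t ^ 2) ∧
        (fun t : ℝ => (Nanotube.edgePlus p a (t • v) n - Nanotube.edgeMinus p a (t • v) n)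
            - t * (2 * Nanotube.xi p v n))
          =O[nhdsWithin 0 (Set.Ioi 0)] (fun t : ℝ => t ^ 2) ∧
        (n ≠ p → ∃ j : Fin 2,
          Nanotube.hat p v j n ≠ 0 ∧ Nanotube.xi p v n = ‖Nanotube.hat p v j n‖) ∧
        (n = p → ∀ j : Fin 2, Nanotube.xi p v n = 2 * ‖Nanotube.hat p v j n‖)) ∧
      (Odd ps →
        (a ≠ 1 →
          (∀ n, 1 ≤ n → n < 2 * p → n ≠ p → Nanotube.psi p a v n ≠ 0) ∧
          ∃ t₀ : ℝ, 0 < t₀ ∧ ∀ t : ℝ, 0 < t → t < t₀ →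
            ∀ n, 1 ≤ n → n < 2 * p → n ≠ p → (Nanotube.gap p a (t • v) n).Nonempty) ∧
        (a = 1 →
          (∀ n, 1 ≤ n → n < 2 * p → Even n → Nanotube.psi p a v n ≠ 0) ∧
          (∀ n, 1 ≤ n → n < 2 * p → Odd n → Nanotube.psi p a v n = 0) ∧
          ∃ t₀ : ℝ, 0 < t₀ ∧ ∀ t : ℝ, 0 < t → t < t₀ →
            ∀ n, 1 ≤ n → n < 2 * p → Even n → (Nanotube.gap p a (t • v) n).Nonempty)) := by
  refine ⟨fun _ => ?_, ?_⟩
  · rcases Nat.even_or_odd ps with h | h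
    · exact frakX_nonempty_of_even hps h
    · exact frakX_nonempty_of_odd h
  intro N _ b k hc p hpd a had v hv
  have hp : 0 < p := hpd ▸ halfPeriod_pos hps
  have ha : 0 < a := had ▸ mul_pos two_pos (abs_pos.2 hc)
  have hper : ∀ x, v (x + ((2 * p : ℕ) : ℤ)) = v x := hpd ▸ periodic_two_mul_halfPeriod hv.1.1
  have hmean : ∑ n ∈ Finset.Icc 1 (2 * p), v (n : ℤ) = 0 := hpd ▸ hv.1.2
  constructor
  · intro heven n hn
    obtain ⟨hn1, hn2, -⟩ := id hn
    have hhat : n ≠ p → hat p v 0 n + hat p v 1 n ≠ 0 ∧ hat p v 0 n * hat p v 1 n = 0 := by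
      intro hnp
      subst hpd
      exact hat_of_even hps heven hv hn1 hn2 hnp
    have hxi := coupling_eq_xi a fun hnp => (hhat hnp).2
    have hO := edge_isBigO hp ha hper hmean hn
    rw [hxi] at hO
    have hself : n = p → ∀ j : Fin 2, xi p v n = 2 * ‖hat p v j n‖ := by
      rintro rfl j
      have h1 := hat_zero_add_hat_one_self hp hmean
      rw [xi, if_pos rfl]
      fin_cases j
      · rw [show hat n v 0 n - hat n v 1 n = 2 * hat n v 0 n by linear_combination -h1]
        simp
      · rw [show hat n v 0 n - hat n v 1 n = -(2 * hat n v 1 n) by linear_combination h1]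
        simp
    refine ⟨?_, hO.1, hO.2.1, hO.2.2, fun hnp => ?_, hself⟩
    · by_cases hnp : n = p
      · rw [hself hnp 0]
        have := (hv.2.1 heven).2
        rw [← hpd, ← hnp] at this
        rw [← hnp]
        positivity
      · rw [xi, if_neg hnp]
        exact norm_pos_iff.2 (hhat hnp).1
    · obtain ⟨h1, h2⟩ := hhat hnp
      rw [xi, if_neg hnp]
      rcases mul_eq_zero.1 h2 with h3 | h3
      · rw [h3, zero_add] at h1 ⊢
        exact ⟨1, h1, rfl⟩
      · rw [h3, add_zero] at h1 ⊢
        exact ⟨0, h1, rfl⟩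
  · intro hodd
    have hh : halfPeriod ps = ps := if_neg (Nat.not_even_iff_odd.2 hodd)
    rw [hh] at hpd
    subst hpd
    have hgap : ∀ n, 1 ≤ n → n < 2 * p → n ≠ p → (a ≠ 1 ∨ Even n) →
        ∀ᶠ t in nhdsWithin (0 : ℝ) (Set.Ioi 0), (gap p a (t • v) n).Nonempty := by
      intro n hn1 hn hnp h
      refine eventually_gap_nonempty hp ha hper hmean ⟨hn1, hn, fun h => absurd h hnp⟩ ?_
      rw [coupling_eq_psi_of_odd hp hodd ha hv.1.1 hn hnp]
      exact psi_ne_zero_of_odd hps hodd ha hv hn1 hn hnp h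
    have hne : ∀ n, Even n → n ≠ p := by
      rintro n he rfl
      exact Nat.not_even_iff_odd.2 hodd he
    refine ⟨fun ha1 => ⟨fun n hn1 hn hnp =>
      psi_ne_zero_of_odd hps hodd ha hv hn1 hn hnp (Or.inl ha1), ?_⟩, fun ha1 =>
      ⟨fun n hn1 hn he => psi_ne_zero_of_odd hps hodd ha hv hn1 hn (hne n he) (Or.inr he),
        fun n _ hn ho => ?_, ?_⟩⟩
    · obtain ⟨t₀, ht₀, H⟩ := exists_forall_gap_nonempty (p := p) (a := a) (v := v)
        (P := fun n => 1 ≤ n ∧ n ≠ p) fun n hn hn2 => hgap n hn.1 hn2 hn.2 (Or.inl ha1)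
      exact ⟨t₀, ht₀, fun t h1 h2 n hn1 hn hnp => H t h1 h2 n ⟨hn1, hnp⟩ hn⟩
    · rw [ha1]
      exact psi_one_eq_zero_of_odd hps hodd hv.1.1 hn ho
    · obtain ⟨t₀, ht₀, H⟩ := exists_forall_gap_nonempty (p := p) (a := a) (v := v)
        (P := fun n => 1 ≤ n ∧ Even n) fun n hn hn2 =>
          hgap n hn.1 hn2 (hne n hn.2) (Or.inr hn.2)
      exact ⟨t₀, ht₀, fun t h1 h2 n hn1 hn he => H t h1 h2 n ⟨hn1, he⟩ hn⟩
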